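/- **Setting.** Let $e(x,y)=A_ex+B_ey+c_e\in\mathbb R^p$ and $h(x,y)=A_hx+B_hy+c_h\in\mathbb R^q$ be affine in $(x,y)\in\mathbb R^n\times\mathbb R^m$, let $X\subseteq\mathbb R^n$ be open, and let $f,g:\mathbb R^n\times\mathbb R^m\to\mathbb R$. Assume that for each $x\in X$ the lower-level problem $\min_y\{g(x,y): h(x,y)\le 0,\ e(x,y)=0\}$ has a solution $y^*(x)$, and put $F(x)=f(x,y^*(x))$. Assume, with Euclidean norms: 1. on $X\times\mathbb R^m$, $f$ is differentiable, $L_f$-Lipschitz and $C_f$-smooth (its gradient is $C_f$-Lipschitz in $(x,y)$); 2. on $X\times\mathbb R^m$, $g$ is twice differentiable, $C_g$-smooth and has an $S_g$-Lipschitz Hessian; $g(x,\cdot)$ is $\mu_g$-strongly convex for each $x\in X$, where $\mu_g>0$. Fix $x\in X$ and let $I$ be the correctly identified active set, $I=\{i:h_i(x,y^*(x))=0\}$. Write $\tilde h=(e,h_I)$, $\tilde A=\nabla_x\tilde h$, $\tilde B=\nabla_y\tilde h$. Assume 3. (LICQ) $\tilde B$ has full row rank; 4. (strict complementarity) there are KKT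 multipliers of the lower-level problem at $(x,y^*(x))$ for which $\lambda^*_i>0$ for all $i\in I$. **Algorithm** (inputs $x$, $I$, a start $y_0$, $\delta>0$, $T\in\mathbb N$; it accesses $f$ and $g$ only by evaluating $\nabla f$ and $\nabla g$, while the constraints are known explicitly): * Run $T$ steps of projected gradient descent with step $1/C_g$ from $y_0$ on $\min\{g(x,y):h(x,y)\le0,\ e(x,y)=0\}$, giving $\tilde y$. Put $\eta=-(\tilde B^\top)^\dagger\nabla_yg(x,\tilde y)$ and form the ghost objective $\tilde g=g+\langle\eta,\tilde h\rangle$ and $\tilde\lambda=-(\tilde B^\top)^\dagger\nabla_y\tilde g(x,\tilde y)$. * Run $T$ steps of projected gradient descent with step $1/(C_g+\delta C_f)$ from $\tilde y$ on the perturbed ghost problem $\min\{\tilde g(x,y)+\delta f(x,y):\tilde h(x,y)=0\}$, giving $\tilde y_\delta$. Put $\tilde\lambda_\delta=-(\tilde B^\top)^\dagger(\nabla_y\tilde g+\delta\nabla_yf)(x,\tilde y_\delta)$. * Put $v_x=\frac1\delta\big(\nabla_x\tilde g(x,\tilde y_\delta)+\tilde A^\top\tilde\lambda_\delta-\nabla_x\tilde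 g(x,\tilde y)-\tilde A^\top\tilde\lambda\big)$ and output $\tilde\nabla F(x)=v_x+\nabla_xf(x,\tilde y)$. **Theorem.** There are constants $c,K>0$ that depend only on $C_f,L_f,C_g,S_g,\mu_g$ and the matrices $A_e,B_e,A_h,B_h$ such that the following holds. For every accuracy $\varepsilon>0$ and every $D\ge0$ there is a number of steps $T$, depending only on these data and on $\varepsilon,D$, such that for all $f,g,X,c_e,c_h,x$ as above and every $y_0$ with $\|y_0-y^*(x)\|\le D$: $F$ is differentiable at $x$; the algorithm with $\delta=c\min\{\varepsilon,1\}$ outputs $\tilde\nabla F(x)$ with $\|\tilde\nabla F(x)-\nabla F(x)\|\le\varepsilon$; and it makes at most $K\log(2+D+1/\varepsilon)$, that is $\tilde O(1)$, evaluations of $\nabla f$ and $\nabla g$. -/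

import Mathlib

noncomputable section

/-- Euclidean space of dimension `k`. -/
abbrev Vec (k : ℕ) : Type := EuclideanSpace ℝ (Fin k)

/-- The joint space of pairs `(x, y)`, with the Euclidean norm. -/
abbrev Pt (n m : ℕ) : Type := WithLp 2 (Vec n × Vec m)

/-- The pair `(x, y)` as a point of the joint Euclidean space. -/
def pt {n m : ℕ} (x : Vec n) (y : Vec m) : Pt n m := WithLp.toLp 2 (x, y)

/-- The points `(x, y)` with `x ∈ X` and `y` arbitrary. -/
def cylinder {n : ℕ} (m : ℕ) (X : Set (Vec n)) : Set (Pt n m) := {z | z.fst ∈ X}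

/-! ### Regularity of the objectives -/

/-- `f` is differentiable, `L`-Lipschitz and `C`-smooth (its gradient is `C`-Lipschitz) on `S`. -/
structure UpperLevelRegular {n m : ℕ} (f : Pt n m → ℝ) (S : Set (Pt n m)) (C L : ℝ) : Prop where
  differentiable : ∀ z ∈ S, DifferentiableAt ℝ f z
  lipschitz : ∀ z ∈ S, ∀ z' ∈ S, |f z - f z'| ≤ L * ‖z - z'‖
  smooth : ∀ z ∈ S, ∀ z' ∈ S, ‖gradient f z - gradient f z'‖ ≤ C * ‖z - z'‖

/-- `g` is twice differentiable, `C`-smooth with `H`-Lipschitz Hessian over `X`, and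
`g (x, ·)` is `μ`-strongly convex for every `x ∈ X`. -/
structure LowerLevelRegular {n m : ℕ} (g : Pt n m → ℝ) (X : Set (Vec n)) (C H μ : ℝ) :
    Prop where
  differentiable : ∀ z ∈ cylinder m X, DifferentiableAt ℝ g z
  smooth : ∀ z ∈ cylinder m X, ∀ z' ∈ cylinder m X,
    ‖gradient g z - gradient g z'‖ ≤ C * ‖z - z'‖
  twice_differentiable : ∀ z ∈ cylinder m X, DifferentiableAt ℝ (gradient g) z
  hessian_lipschitz : ∀ z ∈ cylinder m X, ∀ z' ∈ cylinder m X,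
    ‖fderiv ℝ (gradient g) z - fderiv ℝ (gradient g) z'‖ ≤ H * ‖z - z'‖
  strongly_convex : ∀ x ∈ X, StrongConvexOn Set.univ μ (fun y : Vec m => g (pt x y))

/-! ### Linear constraints -/

/-- Coefficient matrices of `p` linear equality and `q` linear inequality constraints. -/
structure ConstraintMatrices (n m p q : ℕ) where
  Ae : Matrix (Fin p) (Fin n) ℝ
  Be : Matrix (Fin p) (Fin m) ℝ
  Ah : Matrix (Fin q) (Fin n) ℝ
  Bh : Matrix (Fin q) (Fin m) ℝ

namespace ConstraintMatrices

variable {n m p q : ℕ}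

/-- `e(x, y) = Ae x + Be y + ce`. -/
def eqCon (M : ConstraintMatrices n m p q) (ce : Fin p → ℝ) (x : Vec n) (y : Vec m) :
    Fin p → ℝ :=
  Matrix.mulVec M.Ae x.ofLp + Matrix.mulVec M.Be y.ofLp + ce

/-- `h(x, y) = Ah x + Bh y + ch`. -/
def ineqCon (M : ConstraintMatrices n m p q) (ch : Fin q → ℝ) (x : Vec n) (y : Vec m) :
    Fin q → ℝ :=
  Matrix.mulVec M.Ah x.ofLp + Matrix.mulVec M.Bh y.ofLp + ch

/-- The feasible set `{y | h(x, y) ≤ 0, e(x, y) = 0}` of the lower-level problem at `x`. -/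
def feasible (M : ConstraintMatrices n m p q) (ce : Fin p → ℝ) (ch : Fin q → ℝ) (x : Vec n) :
    Set (Vec m) :=
  {y | (∀ i, M.ineqCon ch x y i ≤ 0) ∧ ∀ j, M.eqCon ce x y j = 0}

/-- `y` minimizes `g(x, ·)` over the feasible set at `x`. -/
def IsLowerSolution (M : ConstraintMatrices n m p q) (ce : Fin p → ℝ) (ch : Fin q → ℝ)
    (g : Pt n m → ℝ) (x : Vec n) (y : Vec m) : Prop :=
  y ∈ M.feasible ce ch x ∧ ∀ y' ∈ M.feasible ce ch x, g (pt x y) ≤ g (pt x y')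

/-- KKT conditions of the lower-level problem at `x` for primal `y` and
multipliers `lam` (inequalities), `nu` (equalities). -/
structure IsKKT (M : ConstraintMatrices n m p q) (ce : Fin p → ℝ) (ch : Fin q → ℝ)
    (g : Pt n m → ℝ) (x : Vec n) (y : Vec m) (lam : Fin q → ℝ) (nu : Fin p → ℝ) : Prop where
  primal : y ∈ M.feasible ce ch x
  dual_nonneg : ∀ i, 0 ≤ lam i
  complementary : ∀ i, lam i * M.ineqCon ch x y i = 0
  stationary : (gradient g (pt x y)).snd.ofLp + Matrix.mulVec M.Bh.transpose lam
    + Matrix.mulVec M.Be.transpose nu = 0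

/-- `∇_x` of the stacked constraints `(e, h_I)`. -/
def stackA (M : ConstraintMatrices n m p q) (I : Finset (Fin q)) :
    Matrix (Fin p ⊕ {i // i ∈ I}) (Fin n) ℝ :=
  Matrix.fromRows M.Ae (M.Ah.submatrix Subtype.val id)

/-- `∇_y` of the stacked constraints `(e, h_I)`. -/
def stackB (M : ConstraintMatrices n m p q) (I : Finset (Fin q)) :
    Matrix (Fin p ⊕ {i // i ∈ I}) (Fin m) ℝ :=
  Matrix.fromRows M.Be (M.Bh.submatrix Subtype.val id)

/-- LICQ for the working set `I`: `∇_y (e, h_I)` has full row rank. -/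
def LICQ (M : ConstraintMatrices n m p q) (I : Finset (Fin q)) : Prop :=
  LinearIndependent ℝ (M.stackB I).row

/-- Strict complementarity: KKT multipliers exist for which every
constraint in `I` has a positive multiplier. -/
def StrictComplementarity (M : ConstraintMatrices n m p q) (ce : Fin p → ℝ) (ch : Fin q → ℝ)
    (g : Pt n m → ℝ) (I : Finset (Fin q)) (x : Vec n) (y : Vec m) : Prop :=
  ∃ (lam : Fin q → ℝ) (nu : Fin p → ℝ), M.IsKKT ce ch g x y lam nu ∧ ∀ i ∈ I, 0 < lam i

/-! ### The ghost problem -/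

/-- The feasible set `{y | e(x, y) = 0, h_I(x, y) = 0}` of the ghost problem. For affine `h` and
`h_I(x₀, y₀) = 0`, the function `h_I` is its own linearization at `(x₀, y₀)`. -/
def ghostFeasible (M : ConstraintMatrices n m p q) (ce : Fin p → ℝ) (ch : Fin q → ℝ)
    (I : Finset (Fin q)) (x : Vec n) : Set (Vec m) :=
  {y | (∀ j, M.eqCon ce x y j = 0) ∧ ∀ i ∈ I, M.ineqCon ch x y i = 0}

/-- The gradient of `z ↦ g z + ⟨η, (e, h_I) z⟩` at a point where `g` has gradient `w`. With `η` the
multipliers of the lower-level problem this is the gradient of the ghost objective (multipliers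
of inactive constraints vanish). -/
def lagrangianGrad (M : ConstraintMatrices n m p q) (I : Finset (Fin q))
    (η : Fin p ⊕ {i // i ∈ I} → ℝ) (w : Pt n m) : Pt n m :=
  pt (w.fst + WithLp.toLp 2 (Matrix.mulVec (M.stackA I).transpose η))
    (w.snd + WithLp.toLp 2 (Matrix.mulVec (M.stackB I).transpose η))

/-- The multiplier estimate `-(Bᵀ)† w` for an objective with `y`-gradient `w`, where
`B = ∇_y (e, h_I)`; if `B` has full row rank then `(Bᵀ)† = (B Bᵀ)⁻¹ B`. -/
def dualEstimate (M : ConstraintMatrices n m p q) (I : Finset (Fin q)) (w : Vec m) :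
    Fin p ⊕ {i // i ∈ I} → ℝ :=
  -Matrix.mulVec (M.stackB I * (M.stackB I).transpose)⁻¹ (Matrix.mulVec (M.stackB I) w.ofLp)

end ConstraintMatrices

/-! ### First-order oracle programs -/

/-- Programs that access two functions `f`, `g` on `Z` only by querying their gradients: a program
either returns a value, or queries `∇f` or `∇g` at a point and continues with the answer. -/
inductive OracleProg (Z : Type) (α : Type) : Type
  | ret (a : α) : OracleProg Z α
  | queryF (z : Z) (k : Z → OracleProg Z α) : OracleProg Z α
  | queryG (z : Z) (k : Z → OracleProg Z α) : OracleProg Z α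

namespace OracleProg

variable {Z α β : Type}

/-- Sequential composition. -/
def bind : OracleProg Z α → (α → OracleProg Z β) → OracleProg Z β
  | ret a, r => r a
  | queryF z k, r => queryF z (fun w => (k w).bind r)
  | queryG z k, r => queryG z (fun w => (k w).bind r)

instance : Monad (OracleProg Z) where
  pure := ret
  bind := bind

/-- The output when the queries are answered by `gf` and `gg`. -/
def output (gf gg : Z → Z) : OracleProg Z α → α
  | ret a => a
  | queryF z k => (k (gf z)).output gf gg
  | queryG z k => (k (gg z)).output gf gg

/-- The number of queries made when they are answered by `gf` and `gg`. -/
def queries (gf gg : Z → Z) : OracleProg Z α → ℕ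
  | ret _ => 0
  | queryF z k => (k (gf z)).queries gf gg + 1
  | queryG z k => (k (gg z)).queries gf gg + 1

/-- One query of `∇f`. -/
def askF (z : Z) : OracleProg Z Z := queryF z ret

/-- One query of `∇g`. -/
def askG (z : Z) : OracleProg Z Z := queryG z ret

end OracleProg

/-! ### The algorithm -/

/-- A nearest point of `K` to `u` (the Euclidean projection, if `K` is nonempty, closed, convex). -/
def metricProj {m : ℕ} (K : Set (Vec m)) (u : Vec m) : Vec m :=
  Classical.epsilon (fun v => v ∈ K ∧ ∀ v' ∈ K, ‖u - v‖ ≤ ‖u - v'‖)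

/-- `T` steps `y ↦ proj_K (y - (1 / L) d(y))` of projected gradient descent from a given start,
where the program `d` computes the gradient of the objective. -/
def projGradDescent {Z : Type} {m : ℕ} (d : Vec m → OracleProg Z (Vec m)) (K : Set (Vec m))
    (L : ℝ) : ℕ → Vec m → OracleProg Z (Vec m)
  | 0, y => pure y
  | T + 1, y => do
    let w ← d y
    projGradDescent d K L T (metricProj K (y - (1 / L) • w))

/-- The finite-difference hypergradient oracle at `x`, with identified active set `I`,
perturbation `δ`, `T` projected gradient steps for each of the two inner problems, and start `y₀`.
`Cf`, `Cg` are the smoothness constants of `f`, `g`. -/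
def hypergradientOracle {n m p q : ℕ} (M : ConstraintMatrices n m p q) (ce : Fin p → ℝ)
    (ch : Fin q → ℝ) (Cf Cg : ℝ) (I : Finset (Fin q)) (δ : ℝ) (T : ℕ) (x : Vec n) (y₀ : Vec m) :
    OracleProg (Pt n m) (Vec n) := do
  -- primal and dual solution of the lower-level problem
  let y ← projGradDescent (fun y => do
    let w ← OracleProg.askG (pt x y)
    pure w.snd) (M.feasible ce ch x) Cg T y₀
  let w ← OracleProg.askG (pt x y)
  let η := M.dualEstimate I w.snd
  -- gradient of the ghost objective at `(x, y)`, and the dual of the ghost problem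
  let gw := M.lagrangianGrad I η w
  let lam := M.dualEstimate I gw.snd
  -- primal and dual solution of the ghost problem with objective perturbed by `δ f`
  let yδ ← projGradDescent (fun y => do
    let a ← OracleProg.askG (pt x y)
    let b ← OracleProg.askF (pt x y)
    pure ((M.lagrangianGrad I η a).snd + δ • b.snd)) (M.ghostFeasible ce ch I x) (Cg + δ * Cf) T y
  let wδ ← OracleProg.askG (pt x yδ)
  let uδ ← OracleProg.askF (pt x yδ)
  let gwδ := M.lagrangianGrad I η wδ
  let lamδ := M.dualEstimate I (gwδ.snd + δ • uδ.snd)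
  -- finite difference of the `x`-gradients of the two ghost Lagrangians
  let vx := (1 / δ) • ((M.lagrangianGrad I lamδ gwδ).fst - (M.lagrangianGrad I lam gw).fst)
  let u ← OracleProg.askF (pt x y)
  pure (vx + u.fst)

end

/-!
The solution map `y*` is differentiated without an implicit function theorem. Full row rank and
strong convexity make the linearized KKT system at `(x, y*(x))` uniquely solvable
(`ConstraintMatrices.LICQ.exists_isSensitivity`); it yields linear maps `L` and `Λ` such that
`y*(x) + L (x' - x)`, with the multipliers at `x` shifted by `Λ (x' - x)`, is feasible for `x'` near
`x` and satisfies the KKT conditions there up to `o(x' - x)`. Strict complementarity keeps the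
multipliers nonnegative, so strong monotonicity of `∇_y g` bounds the distance to `y*(x')` by that
residual and `L` is the derivative of `y*` (`hasFDerivAt_lowerSolution`). Hence
`⟨∇F(x), dx⟩ = ⟨∇f(x, y*), (dx, L dx)⟩`.

Write `B = ∇_y (e, h_I)`, `A = ∇_x (e, h_I)` and `J = -B† A`. The multiplier estimates are dual to
`J`, and the shift `η` of the ghost objective cancels, so the output paired with `dx` is, up to
`O(δ)`, the sum of `⟨∇f, (dx, J dx)⟩` and `1 / δ` times the change of `∇g` along `(dx, J dx)`
(`exists_inner_output_hypergradientOracle`). Split `(dx, J dx) = (dx, L dx) - (0, L dx - J dx)`.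
Since `B (L dx - J dx) = 0`, stationarity of the perturbed ghost problem turns the change of `∇g` along
`(0, L dx - J dx)` into `-δ ⟨∇_y f, L dx - J dx⟩`. The change along `(dx, L dx)` is of second order,
because the Hessian `H` of `g` is symmetric and `(H (dx, L dx))_y` is orthogonal to `ker B`. The
Lipschitz Hessian bounds what remains by a multiple of `δ` (`abs_finiteDifference_sub_le`).

This needs the lower-level solution and the ghost stationarity residual only up to `δ²`. Gradient
steps of length `1 / Cg` contract because the Hessian lies between `μg` and `Cg`; adding `δ f`,
which need not be convex, costs `2 δ Cf` in the contraction, harmless for small `δ`. The residual is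
proportional to the difference of two successive iterates, so that the exact perturbed solution is
never used (`ghostIterate_residual_le`). Logarithmically many steps suffice (`exists_stepCount`).
-/

open Filter Topology

/-! ### Strongly convex functions and gradient steps -/

section Hilbert

variable {E : Type*} [NormedAddCommGroup E] [InnerProductSpace ℝ E]

/-- The first-order lower bound for a strongly convex function. -/
theorem StrongConvexOn.add_inner_le [CompleteSpace E] {μ : ℝ} {φ : E → ℝ}
    (hφ : StrongConvexOn Set.univ μ φ) {y G : E} (hG : HasGradientAt φ G y) (y' : E) :
    φ y + inner ℝ G (y' - y) + μ / 2 * ‖y' - y‖ ^ 2 ≤ φ y' := by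
  have hline : HasDerivAt (fun t : ℝ => φ (y + t • (y' - y))) (inner ℝ G (y' - y)) 0 := by
    have h1 : HasDerivAt (fun t : ℝ => y + t • (y' - y)) (y' - y) 0 := by
      simpa using ((hasDerivAt_id (0 : ℝ)).smul_const (y' - y)).const_add y
    have h2 : HasFDerivAt φ (InnerProductSpace.toDual ℝ E G) (y + (0 : ℝ) • (y' - y)) := by
      simpa using hG.hasFDerivAt
    have h3 := h2.comp_hasDerivAt (0 : ℝ) h1
    rwa [InnerProductSpace.toDual_apply_apply] at h3
  have hs := hline.tendsto_slope_zero_right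
  have hr : Tendsto (fun t : ℝ => φ y' - φ y - (1 - t) * (μ / 2 * ‖y' - y‖ ^ 2)) (𝓝[>] 0)
      (𝓝 (φ y' - φ y - (1 - 0) * (μ / 2 * ‖y' - y‖ ^ 2))) :=
    Tendsto.mono_left (Continuous.tendsto (by fun_prop) 0) nhdsWithin_le_nhds
  have hle := le_of_tendsto_of_tendsto hs hr (by
    filter_upwards [Ioo_mem_nhdsGT (show (0 : ℝ) < 1 by norm_num)] with t ht
    have hc := hφ.2 (Set.mem_univ y) (Set.mem_univ y') (sub_nonneg.2 ht.2.le) ht.1.le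
      (sub_add_cancel 1 t)
    have he : (1 - t) • y + t • y' = y + t • (y' - y) := by module
    rw [he, norm_sub_rev] at hc
    simp only [zero_add, zero_smul, add_zero, smul_eq_mul] at hc ⊢
    rw [inv_mul_le_iff₀ ht.1]
    linarith)
  linarith

/-- The gradient of a strongly convex function is strongly monotone. -/
theorem StrongConvexOn.inner_gradient_sub_ge [CompleteSpace E] {μ : ℝ} {φ : E → ℝ}
    (hφ : StrongConvexOn Set.univ μ φ) {y y' G G' : E} (hG : HasGradientAt φ G y)
    (hG' : HasGradientAt φ G' y') :
    μ * ‖y' - y‖ ^ 2 ≤ inner ℝ (G' - G) (y' - y) := by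
  have h1 := hφ.add_inner_le hG y'
  have h2 := hφ.add_inner_le hG' y
  rw [norm_sub_rev y y', ← neg_sub y' y, inner_neg_right] at h2
  rw [inner_sub_left]
  linarith

/-- The derivative of a strongly monotone map is coercive. -/
theorem coercive_of_strongly_monotone {μ : ℝ} {G : E → E} {H : E →L[ℝ] E} {y : E}
    (hG : HasFDerivAt G H y) (hmono : ∀ y', μ * ‖y' - y‖ ^ 2 ≤ inner ℝ (G y' - G y) (y' - y))
    (v : E) : μ * ‖v‖ ^ 2 ≤ inner ℝ (H v) v := by
  have hline : HasDerivAt (fun t : ℝ => G (y + t • v)) (H v) 0 := by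
    have h1 : HasDerivAt (fun t : ℝ => y + t • v) v 0 := by
      simpa using ((hasDerivAt_id (0 : ℝ)).smul_const v).const_add y
    have h2 : HasFDerivAt G H (y + (0 : ℝ) • v) := by simpa using hG
    exact h2.comp_hasDerivAt (0 : ℝ) h1
  have hs := hline.tendsto_slope_zero_right.inner (tendsto_const_nhds (x := v)) (𝕜 := ℝ)
  refine ge_of_tendsto hs ?_
  filter_upwards [self_mem_nhdsWithin] with t ht
  have ht : 0 < t := ht
  have h := hmono (y + t • v)
  simp only [add_sub_cancel_left, norm_smul, Real.norm_eq_abs, inner_smul_right, mul_pow,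
    sq_abs] at h
  simp only [zero_add, zero_smul, add_zero, inner_smul_left, RCLike.conj_to_real]
  rw [inv_mul_eq_div, le_div_iff₀ ht]
  nlinarith

/-- A symmetric operator whose quadratic form lies between `0` and `s‖·‖²` is bounded by `s`. -/
theorem norm_apply_le_of_symmetric {S : E →L[ℝ] E} {s : ℝ} (hs : 0 ≤ s)
    (hsymm : ∀ v w, inner ℝ (S v) w = inner ℝ v (S w)) (hnonneg : ∀ v, 0 ≤ inner ℝ (S v) v)
    (hle : ∀ v, inner ℝ (S v) v ≤ s * ‖v‖ ^ 2) (v : E) : ‖S v‖ ≤ s * ‖v‖ := by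
  -- the quadratic form is nonnegative at `v - t • S v`; then `t = 1 / s`
  have key : ∀ t : ℝ, 0 ≤ s * ‖v‖ ^ 2 - 2 * t * ‖S v‖ ^ 2 + t ^ 2 * (s * ‖S v‖ ^ 2) := by
    intro t
    have h := hnonneg (v - t • S v)
    simp only [map_sub, map_smul, inner_sub_left, inner_sub_right, inner_smul_left,
      inner_smul_right, RCLike.conj_to_real, hsymm (S v) v, real_inner_self_eq_norm_sq] at h
    have h1 := hle v
    have h2 := mul_le_mul_of_nonneg_left (hle (S v)) (sq_nonneg t)
    linarith
  rcases hs.eq_or_lt with rfl | hs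
  · have := key 1
    have h0 : ‖S v‖ ^ 2 = 0 := le_antisymm (by linarith) (by positivity)
    simp [pow_eq_zero_iff] at h0
    simp [h0]
  · have := key s⁻¹
    have h3 : ‖S v‖ ^ 2 ≤ (s * ‖v‖) ^ 2 := by
      have h4 : s * (s * ‖v‖ ^ 2 - 2 * s⁻¹ * ‖S v‖ ^ 2 + s⁻¹ ^ 2 * (s * ‖S v‖ ^ 2))
          = (s * ‖v‖) ^ 2 - ‖S v‖ ^ 2 := by field_simp; ring
      have := mul_nonneg hs.le this
      linarith
    exact le_of_sq_le_sq h3 (by positivity)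

/-- When the Hessians of `φ` are symmetric, `μ`-coercive and bounded by `C`, the gradient `G` of `φ`
makes `C • y - G y` Lipschitz with constant `C - μ`; after division by `C` this says that gradient
steps of length `1 / C` contract. The form without division also covers the zero space, where `C`
may vanish. -/
theorem norm_smul_sub_gradient_sub_le {μ C : ℝ} {G : E → E} {H : E → E →L[ℝ] E}
    (hG : ∀ y, HasFDerivAt G (H y) y)
    (hsymm : ∀ y v w, inner ℝ (H y v) w = inner ℝ v (H y w))
    (hcoer : ∀ y v, μ * ‖v‖ ^ 2 ≤ inner ℝ (H y v) v) (hbd : ∀ y v, ‖H y v‖ ≤ C * ‖v‖)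
    (y y' : E) : ‖C • (y - y') - (G y - G y')‖ ≤ (C - μ) * ‖y - y'‖ := by
  rcases subsingleton_or_nontrivial E with hE | hE
  · simp [Subsingleton.elim y y']
  have hup : ∀ y v, inner ℝ (H y v) v ≤ C * ‖v‖ ^ 2 := fun y v =>
    calc inner ℝ (H y v) v ≤ ‖H y v‖ * ‖v‖ := real_inner_le_norm _ _
      _ ≤ C * ‖v‖ * ‖v‖ := by gcongr; exact hbd y v
      _ = C * ‖v‖ ^ 2 := by ring
  have hs : 0 ≤ C - μ := by
    obtain ⟨v, hv⟩ := exists_ne (0 : E)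
    have := (hcoer y v).trans (hup y v)
    exact sub_nonneg.2 (le_of_mul_le_mul_right this (by positivity))
  have hd : ∀ z, HasFDerivAt (fun y => C • y - G y)
      (C • ContinuousLinearMap.id ℝ E - H z) z := fun z =>
    ((hasFDerivAt_id z).const_smul C).sub (hG z)
  have e : C • (y - y') - (G y - G y') = (C • y - G y) - (C • y' - G y') := by module
  rw [e]
  refine Convex.norm_image_sub_le_of_norm_hasFDerivWithin_le (s := Set.univ)
    (fun z _ => (hd z).hasFDerivWithinAt) (fun z _ => ?_) convex_univ (Set.mem_univ y')
    (Set.mem_univ y)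
  refine ContinuousLinearMap.opNorm_le_bound _ hs
    (norm_apply_le_of_symmetric hs (fun v w => ?_) (fun v => ?_) (fun v => ?_))
  · simp [inner_sub_left, inner_sub_right, inner_smul_left, inner_smul_right, hsymm]
  all_goals
    have h1 := hup z v
    have h2 := hcoer z v
    simp only [sub_apply, smul_apply, ContinuousLinearMap.id_apply, inner_sub_left,
      inner_smul_left, RCLike.conj_to_real, real_inner_self_eq_norm_sq]
    linarith

/-- First-order optimality over a convex set, as a variational inequality. -/
theorem inner_gradient_nonneg_of_isMinOn [CompleteSpace E] {φ : E → ℝ} {K : Set E}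
    (hK : Convex ℝ K) {y G : E} (hG : HasGradientAt φ G y) (hy : y ∈ K)
    (hmin : ∀ y' ∈ K, φ y ≤ φ y') {y' : E} (hy' : y' ∈ K) : 0 ≤ inner ℝ G (y' - y) := by
  have hloc : IsLocalMinOn φ K y := IsMinOn.localize (fun z hz => hmin z hz)
  have := hloc.hasFDerivWithinAt_nonneg hG.hasFDerivAt.hasFDerivWithinAt
    (sub_mem_posTangentConeAt_of_segment_subset (hK.segment_subset hy hy'))
  simpa using this

end Hilbert

/-! ### Projections and projected gradient descent -/

section Projection

variable {m : ℕ} {K : Set (Vec m)}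

theorem metricProj_mem_and_inner_le (hne : K.Nonempty) (hcl : IsClosed K) (hconv : Convex ℝ K)
    (u : Vec m) :
    metricProj K u ∈ K ∧ ∀ w ∈ K, inner ℝ (u - metricProj K u) (w - metricProj K u) ≤ 0 := by
  have hbdd : BddBelow (Set.range fun w : K => ‖u - w‖) :=
    ⟨0, by rintro _ ⟨w, rfl⟩; exact norm_nonneg _⟩
  have hex : ∃ v, v ∈ K ∧ ∀ v' ∈ K, ‖u - v‖ ≤ ‖u - v'‖ := by
    obtain ⟨v, hv, h⟩ := exists_norm_eq_iInf_of_complete_convex hne hcl.isComplete hconv u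
    exact ⟨v, hv, fun v' hv' => h.trans_le (ciInf_le hbdd ⟨v', hv'⟩)⟩
  have hspec : metricProj K u ∈ K ∧ ∀ v' ∈ K, ‖u - metricProj K u‖ ≤ ‖u - v'‖ :=
    Classical.epsilon_spec hex
  refine ⟨hspec.1, (norm_eq_iInf_iff_real_inner_le_zero hconv hspec.1).1 ?_⟩
  have : Nonempty K := hne.to_subtype
  exact le_antisymm (le_ciInf fun w => hspec.2 w w.2) (ciInf_le hbdd ⟨_, hspec.1⟩)

/-- The variational inequality for `v` says that `v` is the projection of `u'`; so this is
nonexpansiveness of the projection, and for `u = u'` it shows that `v` is the projection of `u`. -/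
theorem norm_metricProj_sub_le (hne : K.Nonempty) (hcl : IsClosed K) (hconv : Convex ℝ K)
    {u u' v : Vec m} (hv : v ∈ K) (hvi : ∀ w ∈ K, inner ℝ (u' - v) (w - v) ≤ 0) :
    ‖metricProj K u - v‖ ≤ ‖u - u'‖ := by
  obtain ⟨hP, hPvi⟩ := metricProj_mem_and_inner_le hne hcl hconv u
  have h1 := hvi _ hP
  have h2 := hPvi _ hv
  set P := metricProj K u
  have h3 : ‖P - v‖ ^ 2 ≤ inner ℝ (u - u') (P - v) := by
    have e : u - u' = (u - P) - (u' - v) + (P - v) := by abel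
    rw [e, inner_add_left, inner_sub_left, real_inner_self_eq_norm_sq]
    rw [← neg_sub P v, inner_neg_right] at h2
    linarith
  have h4 := h3.trans (real_inner_le_norm _ _)
  rcases (norm_nonneg (P - v)).eq_or_lt with h0 | h0
  · rw [← h0]; exact norm_nonneg _
  · rw [sq] at h4
    exact le_of_mul_le_mul_right h4 h0

theorem norm_metricProj_sub_metricProj_le (hne : K.Nonempty) (hcl : IsClosed K)
    (hconv : Convex ℝ K) (u u' : Vec m) : ‖metricProj K u - metricProj K u'‖ ≤ ‖u - u'‖ :=
  norm_metricProj_sub_le hne hcl hconv (metricProj_mem_and_inner_le hne hcl hconv u').1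
    (metricProj_mem_and_inner_le hne hcl hconv u').2

/-- Iterates of a contraction approach a fixed point geometrically. -/
theorem norm_iterate_sub_le_of_isFixedPt {E : Type*} [NormedAddCommGroup E] {Ψ : E → E} {ρ : ℝ}
    (hρ : 0 ≤ ρ) (hΨ : ∀ y y', ‖Ψ y - Ψ y'‖ ≤ ρ * ‖y - y'‖) {z : E} (hz : Ψ z = z) (y : E)
    (T : ℕ) : ‖Ψ^[T] y - z‖ ≤ ρ ^ T * ‖y - z‖ := by
  induction T with
  | zero => simp
  | succ T ih =>
    rw [Function.iterate_succ_apply']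
    nth_rewrite 1 [← hz]
    calc _ ≤ ρ * ‖Ψ^[T] y - z‖ := hΨ _ _
      _ ≤ ρ * (ρ ^ T * ‖y - z‖) := by gcongr
      _ = _ := by ring

/-- The successive differences of the iterates of a contraction decay geometrically. -/
theorem norm_iterate_succ_sub_le {E : Type*} [NormedAddCommGroup E] {Ψ : E → E} {ρ : ℝ}
    (hρ : 0 ≤ ρ) (hΨ : ∀ y y', ‖Ψ y - Ψ y'‖ ≤ ρ * ‖y - y'‖) (y : E) (T : ℕ) :
    ‖Ψ (Ψ^[T] y) - Ψ^[T] y‖ ≤ ρ ^ T * ‖Ψ y - y‖ := by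
  induction T with
  | zero => simp
  | succ T ih =>
    rw [Function.iterate_succ_apply']
    calc _ ≤ ρ * ‖Ψ (Ψ^[T] y) - Ψ^[T] y‖ := hΨ _ _
      _ ≤ ρ * (ρ ^ T * ‖Ψ y - y‖) := by gcongr
      _ = _ := by ring

end Projection

/-! ### The joint space -/

section Pt

variable {n m : ℕ}

@[simp] theorem pt_fst (x : Vec n) (y : Vec m) : (pt x y).fst = x := rfl

@[simp] theorem pt_snd (x : Vec n) (y : Vec m) : (pt x y).snd = y := rfl

theorem pt_sub_pt (x x' : Vec n) (y y' : Vec m) : pt x y - pt x' y' = pt (x - x') (y - y') := rfl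

theorem pt_add_pt (x x' : Vec n) (y y' : Vec m) : pt x y + pt x' y' = pt (x + x') (y + y') := rfl

theorem inner_pt_right (w : Pt n m) (x : Vec n) (y : Vec m) :
    inner ℝ w (pt x y) = inner ℝ w.fst x + inner ℝ w.snd y :=
  WithLp.prod_inner_apply _ _

theorem norm_pt_zero_left (y : Vec m) : ‖pt (0 : Vec n) y‖ = ‖y‖ := WithLp.norm_toLp_snd 2 _ _ y

theorem norm_pt_le (x : Vec n) (y : Vec m) : ‖pt x y‖ ≤ ‖x‖ + ‖y‖ := by
  have h : pt x y = pt x 0 + pt 0 y := by simp [pt_add_pt]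
  rw [h]
  refine (norm_add_le _ _).trans (add_le_add (le_of_eq ?_) (le_of_eq (norm_pt_zero_left y)))
  exact WithLp.norm_toLp_fst 2 _ _ x

theorem norm_fst_le_norm (w : Pt n m) : ‖w.fst‖ ≤ ‖w‖ := WithLp.norm_fst_le _ w

theorem norm_snd_le_norm (w : Pt n m) : ‖w.snd‖ ≤ ‖w‖ := WithLp.norm_snd_le _ w

/-- The continuous linear map `v ↦ (a v, b v)` into the joint space. -/
noncomputable def ptL {E : Type*} [NormedAddCommGroup E] [NormedSpace ℝ E] (a : E →L[ℝ] Vec n)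
    (b : E →L[ℝ] Vec m) : E →L[ℝ] Pt n m :=
  ((WithLp.prodContinuousLinearEquiv 2 ℝ (Vec n) (Vec m)).symm :
    Vec n × Vec m →L[ℝ] Pt n m).comp (a.prod b)

@[simp] theorem ptL_apply {E : Type*} [NormedAddCommGroup E] [NormedSpace ℝ E]
    (a : E →L[ℝ] Vec n) (b : E →L[ℝ] Vec m) (v : E) : ptL a b v = pt (a v) (b v) := rfl

theorem hasFDerivAt_pt {E : Type*} [NormedAddCommGroup E] [NormedSpace ℝ E] {a : E → Vec n}
    {b : E → Vec m} {a' : E →L[ℝ] Vec n} {b' : E →L[ℝ] Vec m} {v : E} (ha : HasFDerivAt a a' v)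
    (hb : HasFDerivAt b b' v) : HasFDerivAt (fun v => pt (a v) (b v)) (ptL a' b') v :=
  ((WithLp.prodContinuousLinearEquiv 2 ℝ (Vec n) (Vec m)).symm :
    Vec n × Vec m →L[ℝ] Pt n m).hasFDerivAt.comp v (ha.prodMk hb)

theorem hasFDerivAt_pt_right (x : Vec n) (y : Vec m) :
    HasFDerivAt (fun y : Vec m => pt x y) (ptL 0 (ContinuousLinearMap.id ℝ (Vec m))) y :=
  hasFDerivAt_pt (hasFDerivAt_const x y) (hasFDerivAt_id y)

theorem hasGradientAt_section {g : Pt n m → ℝ} {x : Vec n} {y : Vec m}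
    (hg : DifferentiableAt ℝ g (pt x y)) :
    HasGradientAt (fun y => g (pt x y)) (gradient g (pt x y)).snd y := by
  have h := hg.hasGradientAt.hasFDerivAt.comp y (hasFDerivAt_pt_right x y)
  rw [hasGradientAt_iff_hasFDerivAt]
  refine h.congr_fderiv (ContinuousLinearMap.ext fun v => ?_)
  simp only [ContinuousLinearMap.comp_apply, ptL_apply, InnerProductSpace.toDual_apply_apply,
    inner_pt_right]
  simp

end Pt

/-! ### Linear constraints -/

theorem inner_toLp_transpose_mulVec {ι : Type*} [Fintype ι] {k : ℕ} (B : Matrix ι (Fin k) ℝ)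
    (η : ι → ℝ) (v : Vec k) :
    inner ℝ (WithLp.toLp 2 (Matrix.mulVec B.transpose η)) v = η ⬝ᵥ Matrix.mulVec B v.ofLp := by
  rw [Matrix.mulVec_transpose, Matrix.dotProduct_mulVec, EuclideanSpace.inner_eq_star_dotProduct,
    dotProduct_comm]
  simp

namespace ConstraintMatrices

variable {n m p q : ℕ} (M : ConstraintMatrices n m p q) (I : Finset (Fin q))

/-- Differences of constraint values, for the stacked constraints `(e, h_I)`. -/
theorem stack_sub (ce : Fin p → ℝ) (ch : Fin q → ℝ) (x x' : Vec n) (y y' : Vec m) :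
    Matrix.mulVec (M.stackA I) (x - x').ofLp + Matrix.mulVec (M.stackB I) (y - y').ofLp
      = Sum.elim (fun j => M.eqCon ce x y j - M.eqCon ce x' y' j)
          (fun i : {i // i ∈ I} => M.ineqCon ch x y i - M.ineqCon ch x' y' i) := by
  funext k
  rcases k with j | i
  · simp [stackA, stackB, eqCon, Matrix.mulVec_sub]
    ring
  · have hA : Matrix.mulVec (M.Ah.submatrix (Subtype.val : {i // i ∈ I} → Fin q) id)
        (x - x').ofLp i = Matrix.mulVec M.Ah (x - x').ofLp i := rfl
    have hB : Matrix.mulVec (M.Bh.submatrix (Subtype.val : {i // i ∈ I} → Fin q) id)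
        (y - y').ofLp i = Matrix.mulVec M.Bh (y - y').ofLp i := rfl
    simp only [stackA, stackB, Matrix.fromRows_mulVec, Pi.add_apply, Sum.elim_inr, hA, hB]
    simp [ineqCon, Matrix.mulVec_sub]
    ring

theorem stackB_sub (ce : Fin p → ℝ) (ch : Fin q → ℝ) (x : Vec n) (y y' : Vec m) :
    Matrix.mulVec (M.stackB I) (y - y').ofLp
      = Sum.elim (fun j => M.eqCon ce x y j - M.eqCon ce x y' j)
          (fun i : {i // i ∈ I} => M.ineqCon ch x y i - M.ineqCon ch x y' i) := by
  rw [← stack_sub]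
  simp

theorem eqCon_combo (ce : Fin p → ℝ) (x : Vec n) (y y' : Vec m) {a b : ℝ} (hab : a + b = 1)
    (j : Fin p) : M.eqCon ce x (a • y + b • y') j = a * M.eqCon ce x y j
      + b * M.eqCon ce x y' j := by
  obtain rfl : b = 1 - a := by linarith
  simp [eqCon, Matrix.mulVec_add, Matrix.mulVec_smul]
  ring

theorem ineqCon_combo (ch : Fin q → ℝ) (x : Vec n) (y y' : Vec m) {a b : ℝ} (hab : a + b = 1)
    (i : Fin q) : M.ineqCon ch x (a • y + b • y') i = a * M.ineqCon ch x y i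
      + b * M.ineqCon ch x y' i := by
  obtain rfl : b = 1 - a := by linarith
  simp [ineqCon, Matrix.mulVec_add, Matrix.mulVec_smul]
  ring

theorem continuous_eqCon (ce : Fin p → ℝ) (j : Fin p) :
    Continuous fun z : Vec n × Vec m => M.eqCon ce z.1 z.2 j := by
  unfold eqCon Matrix.mulVec dotProduct
  simp only [Pi.add_apply]
  fun_prop

theorem continuous_ineqCon (ch : Fin q → ℝ) (i : Fin q) :
    Continuous fun z : Vec n × Vec m => M.ineqCon ch z.1 z.2 i := by
  unfold ineqCon Matrix.mulVec dotProduct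
  simp only [Pi.add_apply]
  fun_prop

theorem convex_feasible (ce : Fin p → ℝ) (ch : Fin q → ℝ) (x : Vec n) :
    Convex ℝ (M.feasible ce ch x) := by
  intro y hy y' hy' a b ha hb hab
  refine ⟨fun i => ?_, fun j => ?_⟩
  · rw [ineqCon_combo _ _ _ _ _ hab]
    nlinarith [mul_nonneg ha (neg_nonneg.2 (hy.1 i)), mul_nonneg hb (neg_nonneg.2 (hy'.1 i))]
  · rw [eqCon_combo _ _ _ _ _ hab, hy.2, hy'.2]; simp

theorem convex_ghostFeasible (ce : Fin p → ℝ) (ch : Fin q → ℝ) (x : Vec n) :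
    Convex ℝ (M.ghostFeasible ce ch I x) := by
  intro y hy y' hy' a b ha hb hab
  refine ⟨fun j => ?_, fun i hi => ?_⟩
  · rw [eqCon_combo _ _ _ _ _ hab, hy.1, hy'.1]; simp
  · rw [ineqCon_combo _ _ _ _ _ hab, hy.2 i hi, hy'.2 i hi]; simp

theorem isClosed_feasible (ce : Fin p → ℝ) (ch : Fin q → ℝ) (x : Vec n) :
    IsClosed (M.feasible ce ch x) := by
  have hc : Continuous fun y : Vec m => (x, y) := by fun_prop
  have e : M.feasible ce ch x
      = (⋂ i, {y | M.ineqCon ch x y i ≤ 0}) ∩ ⋂ j, {y | M.eqCon ce x y j = 0} := by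
    ext y; simp [feasible]
  rw [e]
  exact (isClosed_iInter fun i =>
      isClosed_le ((M.continuous_ineqCon ch i).comp hc) continuous_const).inter
    (isClosed_iInter fun j => isClosed_eq ((M.continuous_eqCon ce j).comp hc) continuous_const)

theorem isClosed_ghostFeasible (ce : Fin p → ℝ) (ch : Fin q → ℝ) (x : Vec n) :
    IsClosed (M.ghostFeasible ce ch I x) := by
  have hc : Continuous fun y : Vec m => (x, y) := by fun_prop
  have e : M.ghostFeasible ce ch I x
      = (⋂ j, {y | M.eqCon ce x y j = 0}) ∩ ⋂ i ∈ I, {y | M.ineqCon ch x y i = 0} := by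
    ext y; simp [ghostFeasible]
  rw [e]
  exact (isClosed_iInter fun j =>
      isClosed_eq ((M.continuous_eqCon ce j).comp hc) continuous_const).inter
    (isClosed_iInter fun i => isClosed_iInter fun _ =>
      isClosed_eq ((M.continuous_ineqCon ch i).comp hc) continuous_const)

variable {I} in
theorem stackB_sub_eq_zero {ce : Fin p → ℝ} {ch : Fin q → ℝ} {x : Vec n} {y y' : Vec m}
    (hy : y ∈ M.ghostFeasible ce ch I x) (hy' : y' ∈ M.ghostFeasible ce ch I x) :
    Matrix.mulVec (M.stackB I) (y - y').ofLp = 0 := by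
  rw [M.stackB_sub I ce ch x]
  funext k
  rcases k with j | i
  · simp [hy.1 j, hy'.1 j]
  · simp [hy.2 i i.2, hy'.2 i i.2]

variable {I} in
theorem add_mem_ghostFeasible {ce : Fin p → ℝ} {ch : Fin q → ℝ} {x : Vec n} {y v : Vec m}
    (hy : y ∈ M.ghostFeasible ce ch I x) (hv : Matrix.mulVec (M.stackB I) v.ofLp = 0) :
    y + v ∈ M.ghostFeasible ce ch I x := by
  have h := M.stackB_sub I ce ch x (y + v) y
  rw [add_sub_cancel_left, hv] at h
  refine ⟨fun j => ?_, fun i hi => ?_⟩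
  · have := congrFun h (Sum.inl j)
    simp [hy.1 j] at this
    exact this.symm
  · have := congrFun h (Sum.inr ⟨i, hi⟩)
    simp [hy.2 i hi] at this
    exact this.symm

variable {M I} in
theorem LICQ.isUnit_det (h : M.LICQ I) : IsUnit (M.stackB I * (M.stackB I).transpose).det := by
  rw [← Matrix.isUnit_iff_isUnit_det, ← Matrix.mulVec_injective_iff_isUnit,
    ← Matrix.coe_mulVecLin, injective_iff_map_eq_zero]
  intro η hη
  rw [Matrix.mulVecLin_apply, ← Matrix.mulVec_mulVec] at hη
  have h0 : inner ℝ (WithLp.toLp 2 (Matrix.mulVec (M.stackB I).transpose η))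
      (WithLp.toLp 2 (Matrix.mulVec (M.stackB I).transpose η)) = (0 : ℝ) := by
    rw [inner_toLp_transpose_mulVec]
    simp [hη]
  rw [inner_self_eq_zero] at h0
  have h1 : Matrix.vecMul η (M.stackB I) = 0 := by
    rw [← Matrix.mulVec_transpose]
    exact congrArg WithLp.ofLp h0
  exact Matrix.vecMul_injective_iff.2 h (by simpa using h1)

/-- The displacement `-B† A dx` of `y`, with `B† = Bᵀ (B Bᵀ)⁻¹`. If `B = ∇_y (e, h_I)` has full row
rank, it is the displacement of least norm that compensates a displacement `dx` of `x` in the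
constraints `(e, h_I)`. -/
noncomputable def compensation : Vec n →L[ℝ] Vec m :=
  LinearMap.toContinuousLinearMap (-Matrix.toEuclideanLin
    ((M.stackB I).transpose * (M.stackB I * (M.stackB I).transpose)⁻¹ * M.stackA I))

theorem ofLp_compensation (dx : Vec n) : (M.compensation I dx).ofLp =
    -Matrix.mulVec (M.stackB I).transpose (Matrix.mulVec
      (M.stackB I * (M.stackB I).transpose)⁻¹ (Matrix.mulVec (M.stackA I) dx.ofLp)) := by
  simp [compensation, Matrix.toEuclideanLin, Matrix.mulVec_mulVec, Matrix.mul_assoc]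

variable {M I} in
theorem LICQ.stackB_compensation (h : M.LICQ I) (dx : Vec n) :
    Matrix.mulVec (M.stackB I) (M.compensation I dx).ofLp
      = -Matrix.mulVec (M.stackA I) dx.ofLp := by
  rw [ofLp_compensation, Matrix.mulVec_neg, Matrix.mulVec_mulVec, Matrix.mulVec_mulVec,
    Matrix.mul_nonsing_inv _ h.isUnit_det, Matrix.one_mulVec]

/-- The multiplier estimate is dual to the compensating displacement. This holds without full row
rank, as it only uses that the (possibly junk) inverse of `B Bᵀ` is symmetric. -/
theorem dualEstimate_dotProduct (w : Vec m) (dx : Vec n) :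
    M.dualEstimate I w ⬝ᵥ Matrix.mulVec (M.stackA I) dx.ofLp
      = inner ℝ w (M.compensation I dx) := by
  have hS : ((M.stackB I * (M.stackB I).transpose)⁻¹).transpose
      = (M.stackB I * (M.stackB I).transpose)⁻¹ := by
    rw [Matrix.transpose_nonsing_inv, Matrix.transpose_mul, Matrix.transpose_transpose]
  rw [EuclideanSpace.inner_eq_star_dotProduct, ofLp_compensation, dualEstimate]
  rw [star_trivial, neg_dotProduct, neg_dotProduct, Matrix.mulVec_transpose,
    ← Matrix.dotProduct_mulVec]
  congr 1
  rw [← Matrix.vecMul_transpose, hS, ← Matrix.dotProduct_mulVec, dotProduct_comm,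
    dotProduct_comm]

end ConstraintMatrices

/-! ### Semantics of the algorithm -/

namespace OracleProg

variable {Z α β : Type} (gf gg : Z → Z)

@[simp] theorem output_pure (a : α) : (pure a : OracleProg Z α).output gf gg = a := rfl

@[simp] theorem queries_pure (a : α) : (pure a : OracleProg Z α).queries gf gg = 0 := rfl

@[simp] theorem output_askF (z : Z) : (askF z).output gf gg = gf z := rfl

@[simp] theorem output_askG (z : Z) : (askG z).output gf gg = gg z := rfl

@[simp] theorem queries_askF (z : Z) : (askF z).queries gf gg = 1 := rfl

@[simp] theorem queries_askG (z : Z) : (askG z).queries gf gg = 1 := rfl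

@[simp] theorem output_bind (P : OracleProg Z α) (r : α → OracleProg Z β) :
    (P >>= r).output gf gg = (r (P.output gf gg)).output gf gg := by
  change (P.bind r).output gf gg = _
  induction P with
  | ret a => rfl
  | queryF z k ih => exact ih _
  | queryG z k ih => exact ih _

@[simp] theorem queries_bind (P : OracleProg Z α) (r : α → OracleProg Z β) :
    (P >>= r).queries gf gg
      = P.queries gf gg + (r (P.output gf gg)).queries gf gg := by
  change (P.bind r).queries gf gg = _
  induction P with
  | ret a => simp [bind, queries, output]
  | queryF z k ih => simp only [bind, queries, output, ih]; ring
  | queryG z k ih => simp only [bind, queries, output, ih]; ring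

theorem output_projGradDescent {m : ℕ} (d : Vec m → OracleProg Z (Vec m)) (K : Set (Vec m))
    (L : ℝ) (T : ℕ) (y : Vec m) : (projGradDescent d K L T y).output gf gg
      = (fun y => metricProj K (y - (1 / L) • (d y).output gf gg))^[T] y := by
  induction T generalizing y with
  | zero => rfl
  | succ T ih => simp only [projGradDescent, output_bind, ih, Function.iterate_succ_apply]

theorem queries_projGradDescent {m : ℕ} (d : Vec m → OracleProg Z (Vec m)) (K : Set (Vec m))
    (L : ℝ) (T : ℕ) (y : Vec m) {c : ℕ} (hc : ∀ y, (d y).queries gf gg = c) :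
    (projGradDescent d K L T y).queries gf gg = c * T := by
  induction T generalizing y with
  | zero => rfl
  | succ T ih => simp only [projGradDescent, queries_bind, ih, hc]; ring

end OracleProg

section Algorithm

variable {n m p q : ℕ} (M : ConstraintMatrices n m p q) (ce : Fin p → ℝ) (ch : Fin q → ℝ)
  (Cf Cg : ℝ) (I : Finset (Fin q)) (δ : ℝ) (T : ℕ) (x : Vec n) (y₀ : Vec m)

theorem queries_hypergradientOracle (gf gg : Pt n m → Pt n m) :
    (hypergradientOracle M ce ch Cf Cg I δ T x y₀).queries gf gg = 3 * T + 4 := by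
  have h1 := fun (K : Set (Vec m)) (L : ℝ) (y : Vec m) =>
    OracleProg.queries_projGradDescent gf gg (fun y => do
      let w ← OracleProg.askG (pt x y)
      pure w.snd) K L T y (c := 1) (fun y => by simp)
  have h2 := fun (η : Fin p ⊕ {i // i ∈ I} → ℝ) (K : Set (Vec m)) (L : ℝ) (y : Vec m) =>
    OracleProg.queries_projGradDescent gf gg (fun y => do
      let a ← OracleProg.askG (pt x y)
      let b ← OracleProg.askF (pt x y)
      pure ((M.lagrangianGrad I η a).snd + δ • b.snd)) K L T y (c := 2) (fun y => by simp)
  simp only [hypergradientOracle, OracleProg.queries_bind, OracleProg.queries_askG,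
    OracleProg.queries_askF, OracleProg.queries_pure, h1, h2]
  ring

/-- The output of the algorithm, paired with a direction `dx`. The dual variables only enter
through the compensating displacement of `y`, and the shift `η` of the ghost objective cancels. -/
theorem exists_inner_output_hypergradientOracle (hI : M.LICQ I) (gf gg : Pt n m → Pt n m) :
    ∃ (η : Fin p ⊕ {i // i ∈ I} → ℝ) (y yδ : Vec m),
      y = (fun y => metricProj (M.feasible ce ch x) (y - (1 / Cg) • (gg (pt x y)).snd))^[T] y₀ ∧
      yδ = (fun y => metricProj (M.ghostFeasible ce ch I x) (y - (1 / (Cg + δ * Cf)) •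
        ((gg (pt x y)).snd + WithLp.toLp 2 (Matrix.mulVec (M.stackB I).transpose η)
          + δ • (gf (pt x y)).snd)))^[T] y ∧
      ∀ dx, inner ℝ ((hypergradientOracle M ce ch Cf Cg I δ T x y₀).output gf gg) dx
        = (1 / δ) * (inner ℝ (gg (pt x yδ) - gg (pt x y)) (pt dx (M.compensation I dx))
            + δ * inner ℝ (gf (pt x yδ)).snd (M.compensation I dx))
          + inner ℝ (gf (pt x y)).fst dx := by
  have key : ∀ (η : Fin p ⊕ {i // i ∈ I} → ℝ) (w : Pt n m) (u : Vec m) (dx : Vec n),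
      inner ℝ (M.lagrangianGrad I (M.dualEstimate I ((M.lagrangianGrad I η w).snd + u))
        (M.lagrangianGrad I η w)).fst dx
        = inner ℝ w (pt dx (M.compensation I dx)) + inner ℝ u (M.compensation I dx) := by
    intro η w u dx
    simp only [ConstraintMatrices.lagrangianGrad, pt_fst, pt_snd, inner_add_left,
      inner_toLp_transpose_mulVec, M.dualEstimate_dotProduct, inner_pt_right,
      hI.stackB_compensation, dotProduct_neg]
    ring
  obtain ⟨y, hy⟩ : ∃ y, y = (fun y =>
    metricProj (M.feasible ce ch x) (y - (1 / Cg) • (gg (pt x y)).snd))^[T] y₀ := ⟨_, rfl⟩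
  refine ⟨M.dualEstimate I (gg (pt x y)).snd, y, _, hy, rfl, fun dx => ?_⟩
  simp only [hypergradientOracle, OracleProg.output_bind, OracleProg.output_askG,
    OracleProg.output_askF, OracleProg.output_pure, OracleProg.output_projGradDescent]
  rw [← hy]
  set η := M.dualEstimate I (gg (pt x y)).snd
  have e : ∀ y : Vec m, (M.lagrangianGrad I η (gg (pt x y))).snd = (gg (pt x y)).snd
    + WithLp.toLp 2 (Matrix.mulVec (M.stackB I).transpose η) := fun _ => rfl
  have k1 := key η (gg (pt x y)) 0 dx
  simp only [add_zero, inner_zero_left] at k1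
  simp only [e] at k1 ⊢
  generalize Nat.iterate _ T y = yδ
  have k2 := key η (gg (pt x yδ)) (δ • (gf (pt x yδ)).snd) dx
  simp only [e] at k2
  rw [inner_add_left, inner_smul_left, inner_sub_left, k1, k2, inner_sub_left, inner_smul_left]
  simp only [RCLike.conj_to_real]
  ring

end Algorithm

/-! ### Regularity of the objectives -/

section Regularity

variable {n m : ℕ}

theorem isOpen_cylinder {X : Set (Vec n)} (hX : IsOpen X) : IsOpen (cylinder m X) :=
  hX.preimage (WithLp.fstL 2 ℝ (Vec n) (Vec m)).continuous

theorem UpperLevelRegular.norm_gradient_le {f : Pt n m → ℝ} {S : Set (Pt n m)} {C L : ℝ}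
    (hf : UpperLevelRegular f S C L) (hS : IsOpen S) (hL : 0 ≤ L) {z : Pt n m} (hz : z ∈ S) :
    ‖gradient f z‖ ≤ L := by
  rw [gradient, LinearIsometryEquiv.norm_map]
  refine (hf.differentiable z hz).hasFDerivAt.le_of_lip' hL ?_
  filter_upwards [hS.mem_nhds hz] with z' hz'
  exact hf.lipschitz z' hz' z hz

namespace LowerLevelRegular

variable {g : Pt n m → ℝ} {X : Set (Vec n)} {C S μ : ℝ} {x : Vec n}

theorem hasGradientAt (hg : LowerLevelRegular g X C S μ) (hx : x ∈ X) (y : Vec m) :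
    HasGradientAt (fun y => g (pt x y)) (gradient g (pt x y)).snd y :=
  hasGradientAt_section (hg.differentiable _ hx)

theorem strongly_monotone (hg : LowerLevelRegular g X C S μ) (hx : x ∈ X) (y y' : Vec m) :
    μ * ‖y' - y‖ ^ 2
      ≤ inner ℝ ((gradient g (pt x y')).snd - (gradient g (pt x y)).snd) (y' - y) :=
  (hg.strongly_convex x hx).inner_gradient_sub_ge (hg.hasGradientAt hx y) (hg.hasGradientAt hx y')

theorem hessian_symm (hg : LowerLevelRegular g X C S μ) (hX : IsOpen X) {z : Pt n m}
    (hz : z ∈ cylinder m X) (v w : Pt n m) :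
    inner ℝ (fderiv ℝ (gradient g) z v) w = inner ℝ v (fderiv ℝ (gradient g) z w) := by
  have h1 : ∀ᶠ z' in 𝓝 z,
      HasFDerivAt g (InnerProductSpace.toDual ℝ (Pt n m) (gradient g z')) z' := by
    filter_upwards [(isOpen_cylinder hX).mem_nhds hz] with z' hz'
    exact (hg.differentiable z' hz').hasGradientAt.hasFDerivAt
  have h2 : HasFDerivAt (fun z' => InnerProductSpace.toDual ℝ (Pt n m) (gradient g z'))
      ((innerSL ℝ : Pt n m →L[ℝ] Pt n m →L[ℝ] ℝ).comp (fderiv ℝ (gradient g) z)) z :=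
    (innerSL ℝ : Pt n m →L[ℝ] Pt n m →L[ℝ] ℝ).hasFDerivAt.comp z
      (hg.twice_differentiable z hz).hasFDerivAt
  have h3 := second_derivative_symmetric_of_eventually h1 h2 v w
  rw [real_inner_comm _ v]
  exact h3

theorem norm_hessian_le (hg : LowerLevelRegular g X C S μ) (hX : IsOpen X) (hC : 0 ≤ C)
    {z : Pt n m} (hz : z ∈ cylinder m X) : ‖fderiv ℝ (gradient g) z‖ ≤ C := by
  refine (hg.twice_differentiable z hz).hasFDerivAt.le_of_lip' hC ?_
  filter_upwards [(isOpen_cylinder hX).mem_nhds hz] with z' hz'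
  exact hg.smooth z' hz' z hz

theorem hasFDerivAt_gradient_snd (hg : LowerLevelRegular g X C S μ) (hx : x ∈ X) (y : Vec m) :
    HasFDerivAt (fun y => (gradient g (pt x y)).snd)
      ((WithLp.sndL 2 ℝ (Vec n) (Vec m)).comp ((fderiv ℝ (gradient g) (pt x y)).comp
        (ptL 0 (ContinuousLinearMap.id ℝ (Vec m))))) y :=
  (WithLp.sndL 2 ℝ (Vec n) (Vec m)).hasFDerivAt.comp y
    ((hg.twice_differentiable (pt x y) hx).hasFDerivAt.comp y (hasFDerivAt_pt_right x y))

theorem hessian_coercive (hg : LowerLevelRegular g X C S μ) (hx : x ∈ X) (y v : Vec m) :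
    μ * ‖v‖ ^ 2 ≤ inner ℝ (fderiv ℝ (gradient g) (pt x y) (pt 0 v)).snd v :=
  coercive_of_strongly_monotone (hg.hasFDerivAt_gradient_snd hx y)
    (fun y' => hg.strongly_monotone hx y y') v

theorem norm_smul_sub_gradient_le (hg : LowerLevelRegular g X C S μ) (hX : IsOpen X)
    (hC : 0 ≤ C) (hx : x ∈ X) (y y' : Vec m) :
    ‖C • (y - y') - ((gradient g (pt x y)).snd - (gradient g (pt x y')).snd)‖
      ≤ (C - μ) * ‖y - y'‖ := by
  refine norm_smul_sub_gradient_sub_le (fun y => hg.hasFDerivAt_gradient_snd hx y)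
    (fun y v w => ?_) (fun y v => hg.hessian_coercive hx y v) (fun y v => ?_) y y'
  · have h := hg.hessian_symm hX (show pt x y ∈ cylinder m X from hx) (pt 0 v) (pt 0 w)
    rw [inner_pt_right, real_inner_comm _ (pt 0 v), inner_pt_right, inner_zero_right,
      inner_zero_right, zero_add, zero_add] at h
    rw [real_inner_comm _ v]
    exact h
  · calc _ ≤ ‖fderiv ℝ (gradient g) (pt x y) (pt 0 v)‖ := norm_snd_le_norm _
      _ ≤ ‖fderiv ℝ (gradient g) (pt x y)‖ * ‖pt (0 : Vec n) v‖ :=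
        ContinuousLinearMap.le_opNorm _ _
      _ ≤ C * ‖v‖ := by
        rw [norm_pt_zero_left]
        gcongr
        exact hg.norm_hessian_le hX hC hx

/-- Second-order Taylor estimate for the gradient along the fibre over `x`. -/
theorem norm_gradient_taylor_le (hg : LowerLevelRegular g X C S μ) (hS : 0 ≤ S) (hx : x ∈ X)
    (y y' : Vec m) :
    ‖gradient g (pt x y') - gradient g (pt x y)
        - fderiv ℝ (gradient g) (pt x y) (pt 0 (y' - y))‖ ≤ S * ‖y' - y‖ ^ 2 := by
  set ι := ptL (0 : Vec m →L[ℝ] Vec n) (ContinuousLinearMap.id ℝ (Vec m))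
  have hι : ‖ι‖ ≤ 1 := ContinuousLinearMap.opNorm_le_bound _ zero_le_one fun v => by
    simp [ι, norm_pt_zero_left]
  have h := Convex.norm_image_sub_le_of_norm_hasFDerivWithin_le' (s := segment ℝ y y')
    (f := fun y => gradient g (pt x y)) (C := S * ‖y' - y‖)
    (f' := fun u => (fderiv ℝ (gradient g) (pt x u)).comp ι)
    (φ := (fderiv ℝ (gradient g) (pt x y)).comp ι)
    (fun u _ => ((hg.twice_differentiable (pt x u) hx).hasFDerivAt.comp u
      (hasFDerivAt_pt_right x u)).hasFDerivWithinAt)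
    (fun u hu => ?_) (convex_segment y y') (left_mem_segment ℝ y y') (right_mem_segment ℝ y y')
  · simpa [ι, sq, mul_assoc] using h
  · rw [← ContinuousLinearMap.sub_comp]
    calc _ ≤ ‖fderiv ℝ (gradient g) (pt x u) - fderiv ℝ (gradient g) (pt x y)‖ * ‖ι‖ :=
          ContinuousLinearMap.opNorm_comp_le _ _
      _ ≤ (S * ‖pt x u - pt x y‖) * 1 := by
          gcongr
          exact hg.hessian_lipschitz _ hx _ hx
      _ ≤ S * ‖y' - y‖ := by
          rw [mul_one, pt_sub_pt, sub_self, norm_pt_zero_left]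
          gcongr
          exact norm_sub_le_of_mem_segment hu

end LowerLevelRegular

end Regularity

/-! ### Sensitivity of the lower-level solution -/

section Sensitivity

variable {n m p q : ℕ} {M : ConstraintMatrices n m p q} {I : Finset (Fin q)}

/-- Solvability of the linearized KKT system: by coercivity of `A` and full row rank of
`B = ∇_y (e, h_I)` its homogeneous version has only the zero solution. -/
theorem ConstraintMatrices.LICQ.exists_linearized_kkt (hI : M.LICQ I) {μ : ℝ} (hμ : 0 < μ)
    (A : Vec m →L[ℝ] Vec m) (hA : ∀ v, μ * ‖v‖ ^ 2 ≤ inner ℝ (A v) v) (R : Vec n →L[ℝ] Vec m) :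
    ∃ (L : Vec n →L[ℝ] Vec m) (Λ : Vec n →L[ℝ] (Fin p ⊕ {i // i ∈ I} → ℝ)), ∀ dx,
      A (L dx) + WithLp.toLp 2 (Matrix.mulVec (M.stackB I).transpose (Λ dx)) = -R dx ∧
      Matrix.mulVec (M.stackB I) (L dx).ofLp = -Matrix.mulVec (M.stackA I) dx.ofLp := by
  let e : (Fin m → ℝ) ≃ₗ[ℝ] Vec m := (WithLp.linearEquiv 2 ℝ (Fin m → ℝ)).symm
  let K : (Vec m × (Fin p ⊕ {i // i ∈ I} → ℝ)) →ₗ[ℝ] (Vec m × (Fin p ⊕ {i // i ∈ I} → ℝ)) :=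
    ((A : Vec m →ₗ[ℝ] Vec m).coprod
      (e.toLinearMap ∘ₗ (M.stackB I).transpose.mulVecLin)).prod
    (((M.stackB I).mulVecLin ∘ₗ e.symm.toLinearMap) ∘ₗ LinearMap.fst ℝ _ _)
  have hK : ∀ v η, K (v, η) = (A v + WithLp.toLp 2 (Matrix.mulVec (M.stackB I).transpose η),
      Matrix.mulVec (M.stackB I) v.ofLp) := fun v η => rfl
  have hinj : Function.Injective K := by
    rw [injective_iff_map_eq_zero]
    rintro ⟨v, η⟩ h
    rw [hK, Prod.mk_eq_zero] at h
    obtain ⟨h1, h2⟩ := h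
    have hv : v = 0 := by
      have h3 : inner ℝ (A v) v = 0 := by
        have := congrArg (fun u => inner ℝ u v) h1
        simpa [inner_add_left, inner_toLp_transpose_mulVec, h2] using this
      have h4 := hA v
      rw [h3] at h4
      have h5 : ‖v‖ ^ 2 ≤ 0 := nonpos_of_mul_nonpos_right h4 hμ
      simpa using pow_eq_zero_iff two_ne_zero |>.1 (le_antisymm h5 (sq_nonneg _))
    subst hv
    rw [map_zero, zero_add] at h1
    have h6 : Matrix.vecMul η (M.stackB I) = 0 := by
      rw [← Matrix.mulVec_transpose]
      exact congrArg WithLp.ofLp h1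
    rw [Prod.mk_eq_zero]
    exact ⟨rfl, Matrix.vecMul_injective_iff.2 hI (by simpa using h6)⟩
  let Ke := LinearEquiv.ofInjectiveEndo K hinj
  let rhs : Vec n →ₗ[ℝ] (Vec m × (Fin p ⊕ {i // i ∈ I} → ℝ)) :=
    (-(R : Vec n →ₗ[ℝ] Vec m)).prod
      (-((M.stackA I).mulVecLin ∘ₗ (WithLp.linearEquiv 2 ℝ (Fin n → ℝ)).toLinearMap))
  let sol := Ke.symm.toLinearMap ∘ₗ rhs
  refine ⟨LinearMap.toContinuousLinearMap (LinearMap.fst ℝ _ _ ∘ₗ sol),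
    LinearMap.toContinuousLinearMap (LinearMap.snd ℝ _ _ ∘ₗ sol), fun dx => ?_⟩
  have h : K (sol dx) = rhs dx := Ke.apply_symm_apply (rhs dx)
  have h' : K ((sol dx).1, (sol dx).2) = rhs dx := h
  rw [hK] at h'
  exact ⟨congrArg Prod.fst h', congrArg Prod.snd h'⟩

/-- The linear map `L` is the first-order response of the solution of the ghost problem, where `H`
is the Hessian of the lower-level objective: `(dx, L dx)` is tangent to the constraints
`(e, h_I) = 0`, and along it the change of `∇_y g` stays in the row space of `B = ∇_y (e, h_I)`;
`Λ dx` is the response of the multipliers. -/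
structure IsSensitivity (M : ConstraintMatrices n m p q) (I : Finset (Fin q))
    (H : Pt n m →L[ℝ] Pt n m) (L : Vec n →L[ℝ] Vec m)
    (Λ : Vec n →L[ℝ] (Fin p ⊕ {i // i ∈ I} → ℝ)) : Prop where
  stationary : ∀ dx, (H (pt dx (L dx))).snd
    + WithLp.toLp 2 (Matrix.mulVec (M.stackB I).transpose (Λ dx)) = 0
  tangent : ∀ dx, Matrix.mulVec (M.stackB I) (L dx).ofLp = -Matrix.mulVec (M.stackA I) dx.ofLp

theorem ConstraintMatrices.LICQ.exists_isSensitivity (hI : M.LICQ I) {μ : ℝ} (hμ : 0 < μ)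
    (H : Pt n m →L[ℝ] Pt n m) (hH : ∀ v, μ * ‖v‖ ^ 2 ≤ inner ℝ (H (pt 0 v)).snd v) :
    ∃ L Λ, IsSensitivity M I H L Λ := by
  obtain ⟨L, Λ, h⟩ := hI.exists_linearized_kkt hμ
    ((WithLp.sndL 2 ℝ (Vec n) (Vec m)).comp (H.comp (ptL 0 (ContinuousLinearMap.id ℝ (Vec m))))) hH
    ((WithLp.sndL 2 ℝ (Vec n) (Vec m)).comp (H.comp (ptL (ContinuousLinearMap.id ℝ (Vec n)) 0)))
  refine ⟨L, Λ, fun dx => ?_, fun dx => (h dx).2⟩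
  have h1 : (H (pt 0 (L dx))).snd + WithLp.toLp 2 (Matrix.mulVec (M.stackB I).transpose (Λ dx))
    = -(H (pt dx 0)).snd := (h dx).1
  have h2 : pt dx (L dx) = pt dx 0 + pt 0 (L dx) := by simp [pt_add_pt]
  rw [h2, map_add, WithLp.add_snd, add_assoc, h1, add_neg_cancel]

/-- The KKT multipliers vanish off the active set, so that stationarity only involves the stacked
active constraints. -/
theorem ConstraintMatrices.StrictComplementarity.exists_multiplier {ce : Fin p → ℝ}
    {ch : Fin q → ℝ} {g : Pt n m → ℝ} {x : Vec n} {y : Vec m}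
    (h : M.StrictComplementarity ce ch g I x y) (hI : ∀ i, i ∈ I ↔ M.ineqCon ch x y i = 0) :
    ∃ η : Fin p ⊕ {i // i ∈ I} → ℝ, (∀ i, 0 < η (Sum.inr i)) ∧
      (gradient g (pt x y)).snd
        + WithLp.toLp 2 (Matrix.mulVec (M.stackB I).transpose η) = 0 := by
  obtain ⟨lam, nu, hk, hpos⟩ := h
  refine ⟨Sum.elim nu (fun i => lam i), fun i => hpos i i.2, ?_⟩
  have hz : ∀ i, i ∉ I → lam i = 0 := fun i hi =>
    (mul_eq_zero.1 (hk.complementary i)).resolve_right (fun h0 => hi ((hI i).2 h0))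
  apply WithLp.ofLp_injective 2
  have hs := hk.stationary
  funext k
  have hs := congrFun hs k
  simp only [Matrix.mulVec, dotProduct, Matrix.transpose_apply, Pi.add_apply, Pi.zero_apply] at hs
  simp only [Matrix.mulVec, dotProduct, Matrix.transpose_apply, stackB, WithLp.ofLp_add,
    Pi.add_apply, Fintype.sum_sum_type, Matrix.fromRows_apply_inl, Matrix.fromRows_apply_inr,
    Sum.elim_inl, Sum.elim_inr, Matrix.submatrix_apply, id, WithLp.ofLp_zero, Pi.zero_apply]
  have e : ∑ i : {i // i ∈ I}, M.Bh i k * lam i = ∑ i, M.Bh i k * lam i := by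
    rw [Finset.sum_coe_sort I (fun i => M.Bh i k * lam i)]
    exact Finset.sum_subset (Finset.subset_univ I) fun i _ hi => by rw [hz i hi, mul_zero]
  rw [e]
  linarith

/-- The lower-level solution map is differentiable. The point `y₁ = y*(x) + L (x' - x)` is feasible
near `x` and satisfies the KKT conditions at `x'`, with nonnegative multipliers by strict
complementarity, up to a residual `o(x' - x)`; strong monotonicity of `∇_y g` then bounds its
distance to the solution `y*(x')` by that residual. -/
theorem hasFDerivAt_lowerSolution {ce : Fin p → ℝ} {ch : Fin q → ℝ} {g : Pt n m → ℝ}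
    {X : Set (Vec n)} {C S μ : ℝ} (hg : LowerLevelRegular g X C S μ) (hX : IsOpen X) (hμ : 0 < μ)
    {x : Vec n} (hx : x ∈ X) {ystar : Vec n → Vec m}
    (hsol : ∀ x' ∈ X, M.IsLowerSolution ce ch g x' (ystar x'))
    (hI : ∀ i, i ∈ I ↔ M.ineqCon ch x (ystar x) i = 0) {η : Fin p ⊕ {i // i ∈ I} → ℝ}
    (hη : ∀ i, 0 < η (Sum.inr i))
    (hst : (gradient g (pt x (ystar x))).snd
      + WithLp.toLp 2 (Matrix.mulVec (M.stackB I).transpose η) = 0)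
    {L : Vec n →L[ℝ] Vec m} {Λ : Vec n →L[ℝ] (Fin p ⊕ {i // i ∈ I} → ℝ)}
    (hL : IsSensitivity M I (fderiv ℝ (gradient g) (pt x (ystar x))) L Λ) :
    HasFDerivAt ystar L x := by
  set y₁ : Vec n → Vec m := fun x' => ystar x + L (x' - x) with hy₁
  have hy₁x : y₁ x = ystar x := by simp [hy₁]
  have hsubd : HasFDerivAt (fun x' : Vec n => x' - x) (ContinuousLinearMap.id ℝ (Vec n)) x :=
    (hasFDerivAt_id x).sub_const x
  have hy₁d : HasFDerivAt y₁ L x := by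
    exact (L.hasFDerivAt.comp x hsubd).const_add (ystar x)
  set r : Vec n → Vec m := fun x' => (gradient g (pt x' (y₁ x'))).snd
    + WithLp.toLp 2 (Matrix.mulVec (M.stackB I).transpose (η + Λ (x' - x))) with hr
  -- the stationarity residual of `y₁ x'` with the linearized multipliers
  have hro : r =o[𝓝 x] fun x' => x' - x := by
    have h1 : HasFDerivAt (fun x' => gradient g (pt x' (y₁ x')))
        ((fderiv ℝ (gradient g) (pt x (ystar x))).comp
          (ptL (ContinuousLinearMap.id ℝ (Vec n)) L)) x := by
      have h := (hg.twice_differentiable (pt x (ystar x)) hx).hasFDerivAt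
      rw [← hy₁x] at h
      have h' := h.comp x (hasFDerivAt_pt (hasFDerivAt_id x) hy₁d)
      rw [hy₁x] at h'
      exact h'
    have h2 := ((WithLp.sndL 2 ℝ (Vec n) (Vec m)).hasFDerivAt.comp x h1).isLittleO
    refine h2.congr_left fun x' => ?_
    have h3 := hL.stationary (x' - x)
    have e1 : (gradient g (pt x (ystar x))).snd
      = -WithLp.toLp 2 (Matrix.mulVec (M.stackB I).transpose η) := eq_neg_of_add_eq_zero_left hst
    have e2 := eq_neg_of_add_eq_zero_left h3
    change (gradient g (pt x' (y₁ x'))).snd - (gradient g (pt x (y₁ x))).snd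
      - (fderiv ℝ (gradient g) (pt x (ystar x)) (pt (x' - x) (L (x' - x)))).snd = _
    rw [hy₁x, e1, e2, hr]
    simp only [Matrix.mulVec_add, WithLp.toLp_add]
    abel
  have hfeas : ∀ᶠ x' in 𝓝 x, ∀ i, M.ineqCon ch x' (y₁ x') i ≤ 0 := by
    rw [eventually_all]
    intro i
    by_cases hi : i ∈ I
    · refine Eventually.of_forall fun x' => le_of_eq ?_
      have h := M.stack_sub I ce ch x' x (y₁ x') (ystar x)
      rw [show y₁ x' - ystar x = L (x' - x) by simp [hy₁], hL.tangent, add_neg_cancel] at h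
      have h := congrFun h (Sum.inr ⟨i, hi⟩)
      simp only [Pi.zero_apply, Sum.elim_inr, (hI i).1 hi, sub_zero] at h
      exact h.symm
    · have hlt : M.ineqCon ch x (ystar x) i < 0 :=
        lt_of_le_of_ne ((hsol x hx).1.1 i) (fun h => hi ((hI i).2 h))
      have hc : ContinuousAt (fun x' => M.ineqCon ch x' (y₁ x') i) x :=
        (M.continuous_ineqCon ch i).continuousAt.comp
          (f := fun x' => (x', y₁ x')) (continuousAt_id.prodMk hy₁d.continuousAt)
      rw [← hy₁x] at hlt
      exact (hc.eventually_lt continuousAt_const hlt).mono fun _ h => h.le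
  have hdual : ∀ᶠ x' in 𝓝 x, ∀ i, 0 ≤ (η + Λ (x' - x)) (Sum.inr i) := by
    rw [eventually_all]
    intro i
    have hc : ContinuousAt (fun x' => (η + Λ (x' - x)) (Sum.inr i)) x := by
      simp only [Pi.add_apply]
      fun_prop
    refine (continuousAt_const.eventually_lt hc ?_).mono fun _ h => h.le
    simpa using hη i
  have hbound : ∀ᶠ x' in 𝓝 x, ‖ystar x' - y₁ x'‖ ≤ (1 / μ) * ‖r x'‖ := by
    filter_upwards [hfeas, hdual, hX.mem_nhds hx] with x' hf hd hx'
    have hmem : y₁ x' ∈ M.feasible ce ch x' := by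
      refine ⟨hf, fun j => ?_⟩
      have h := M.stack_sub I ce ch x' x (y₁ x') (ystar x)
      rw [show y₁ x' - ystar x = L (x' - x) by simp [hy₁], hL.tangent, add_neg_cancel] at h
      have h := congrFun h (Sum.inl j)
      simp only [Pi.zero_apply, Sum.elim_inl, (hsol x hx).1.2 j, sub_zero] at h
      exact h.symm
    have hvi := inner_gradient_nonneg_of_isMinOn (M.convex_feasible ce ch x')
      (hg.hasGradientAt hx' (ystar x')) (hsol x' hx').1 (hsol x' hx').2 hmem
    have hmono := hg.strongly_monotone hx' (ystar x') (y₁ x')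
    -- with nonnegative multipliers, feasibility of `y*(x')` gives the sign of the multiplier term
    have hcompl : 0 ≤ (η + Λ (x' - x)) ⬝ᵥ
        Matrix.mulVec (M.stackB I) (y₁ x' - ystar x').ofLp := by
      rw [M.stackB_sub I ce ch x']
      refine Finset.sum_nonneg fun k _ => ?_
      rcases k with j | i
      · simp [hmem.2 j, (hsol x' hx').1.2 j]
      · have e : M.ineqCon ch x' (y₁ x') i = 0 := by
          have h := M.stack_sub I ce ch x' x (y₁ x') (ystar x)
          rw [show y₁ x' - ystar x = L (x' - x) by simp [hy₁], hL.tangent, add_neg_cancel] at h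
          have h := congrFun h (Sum.inr i)
          simp only [Pi.zero_apply, Sum.elim_inr, (hI i).1 i.2, sub_zero] at h
          exact h.symm
        refine mul_nonneg (hd i) ?_
        rw [Sum.elim_inr, e, zero_sub]
        exact neg_nonneg.2 ((hsol x' hx').1.1 i)
    rw [← inner_toLp_transpose_mulVec] at hcompl
    have e : (gradient g (pt x' (y₁ x'))).snd = r x'
        - WithLp.toLp 2 (Matrix.mulVec (M.stackB I).transpose (η + Λ (x' - x))) := by
      simp [hr]
    rw [inner_sub_left, e, inner_sub_left] at hmono
    have h1 : μ * ‖y₁ x' - ystar x'‖ ^ 2 ≤ ‖r x'‖ * ‖y₁ x' - ystar x'‖ :=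
      (by linarith : _ ≤ inner ℝ (r x') (y₁ x' - ystar x')).trans (real_inner_le_norm _ _)
    rw [norm_sub_rev, one_div, ← div_eq_inv_mul, le_div_iff₀ hμ]
    rcases (norm_nonneg (y₁ x' - ystar x')).eq_or_lt with h0 | h0
    · rw [← h0]; simp
    · exact le_of_mul_le_mul_right (by linarith) h0
  refine HasFDerivAt.of_isLittleO ?_
  refine ((Asymptotics.IsBigO.of_bound _ hbound).trans_isLittleO hro).congr_left fun x' => ?_
  simp only [hy₁]
  abel

/-- The bound for `L - J` depends only on the regularity constants and on `J`: the difference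
`L dx - J dx` lies in `ker B`, where `H` is coercive, and solves a linear equation with right-hand
side `-H (dx, J dx)`. -/
theorem IsSensitivity.norm_sub_le {H : Pt n m →L[ℝ] Pt n m} {L J : Vec n →L[ℝ] Vec m}
    {Λ : Vec n →L[ℝ] (Fin p ⊕ {i // i ∈ I} → ℝ)} (hL : IsSensitivity M I H L Λ) {C μ j : ℝ}
    (hμ : 0 < μ) (hC : ‖H‖ ≤ C) (hH : ∀ v, μ * ‖v‖ ^ 2 ≤ inner ℝ (H (pt 0 v)).snd v)
    (hJ : ∀ dx, Matrix.mulVec (M.stackB I) (J dx).ofLp = -Matrix.mulVec (M.stackA I) dx.ofLp)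
    (hj : ‖J‖ ≤ j) (dx : Vec n) : ‖L dx - J dx‖ ≤ C * (1 + j) / μ * ‖dx‖ := by
  have hker : Matrix.mulVec (M.stackB I) (L dx - J dx).ofLp = 0 := by
    rw [WithLp.ofLp_sub, Matrix.mulVec_sub, hL.tangent, hJ, sub_self]
  set ℓ := L dx - J dx
  have h1 : inner ℝ (H (pt dx (L dx))).snd ℓ = 0 := by
    rw [eq_neg_of_add_eq_zero_left (hL.stationary dx), inner_neg_left,
      inner_toLp_transpose_mulVec, hker]
    simp
  have e : pt dx (L dx) = pt dx (J dx) + pt 0 ℓ := by simp [pt_add_pt, ℓ]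
  rw [e, map_add, WithLp.add_snd, inner_add_left] at h1
  have h2 : -inner ℝ (H (pt dx (J dx))).snd ℓ ≤ C * ((1 + j) * ‖dx‖) * ‖ℓ‖ := by
    rw [← inner_neg_left]
    refine (real_inner_le_norm _ _).trans ?_
    rw [norm_neg]
    have hJdx : ‖J dx‖ ≤ j * ‖dx‖ := J.le_of_opNorm_le hj dx
    gcongr
    calc _ ≤ ‖H (pt dx (J dx))‖ := norm_snd_le_norm _
      _ ≤ C * ‖pt dx (J dx)‖ := H.le_of_opNorm_le hC _
      _ ≤ C * ((1 + j) * ‖dx‖) := by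
        have : 0 ≤ C := (norm_nonneg _).trans hC
        gcongr
        refine (norm_pt_le _ _).trans ?_
        linarith
  have h3 := hH ℓ
  have h4 : μ * ‖ℓ‖ * ‖ℓ‖ ≤ C * ((1 + j) * ‖dx‖) * ‖ℓ‖ := by
    have : μ * ‖ℓ‖ * ‖ℓ‖ = μ * ‖ℓ‖ ^ 2 := by ring
    linarith
  rw [div_mul_eq_mul_div, le_div_iff₀ hμ, mul_assoc C]
  rcases (norm_nonneg ℓ).eq_or_lt with h0 | h0
  · rw [← h0, zero_mul]
    have : 0 ≤ C := (norm_nonneg _).trans hC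
    have : 0 ≤ j := (norm_nonneg _).trans hj
    positivity
  · linarith [le_of_mul_le_mul_right h4 h0]

end Sensitivity

/-! ### Error of the finite difference -/

section Error

variable {n m p q : ℕ} {M : ConstraintMatrices n m p q} {I : Finset (Fin q)}

/-- An approximate stationary point of the perturbed ghost problem is `O(δ)`-close to the
solution. -/
theorem LowerLevelRegular.norm_sub_le_of_residual {f g : Pt n m → ℝ} {X : Set (Vec n)}
    {Lf C S μ δ R : ℝ} {x : Vec n} (hg : LowerLevelRegular g X C S μ) (hμ : 0 < μ) (hx : x ∈ X)
    (hδ : 0 ≤ δ) (hR : 0 ≤ R) {ys yδ : Vec m} (hfL : ‖gradient f (pt x yδ)‖ ≤ Lf)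
    (hst : inner ℝ (gradient g (pt x ys)).snd (yδ - ys) = 0)
    (hres : |inner ℝ ((gradient g (pt x yδ)).snd + δ • (gradient f (pt x yδ)).snd) (yδ - ys)|
      ≤ R * ‖yδ - ys‖) : ‖yδ - ys‖ ≤ (δ * Lf + R) / μ := by
  have h1 := hg.strongly_monotone hx ys yδ
  have h2 := (abs_le.1 hres).2
  have h3 : -inner ℝ (gradient f (pt x yδ)).snd (yδ - ys) ≤ Lf * ‖yδ - ys‖ := by
    rw [← inner_neg_left]
    refine (real_inner_le_norm _ _).trans ?_
    rw [norm_neg]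
    gcongr
    exact (norm_snd_le_norm _).trans hfL
  have h4 := mul_le_mul_of_nonneg_left h3 hδ
  rw [inner_sub_left, hst] at h1
  rw [inner_add_left, inner_smul_left, RCLike.conj_to_real] at h2
  rw [le_div_iff₀ hμ]
  rcases (norm_nonneg (yδ - ys)).eq_or_lt with h0 | h0
  · rw [← h0, zero_mul]
    exact add_nonneg (mul_nonneg hδ ((norm_nonneg _).trans hfL)) hR
  · refine le_of_mul_le_mul_right ?_ h0
    nlinarith

/-- The error bound for the finite-difference estimate, given a lower-level solution with error
`δ²` and a point of the perturbed ghost problem with stationarity residual `δ²`. Along `(dx, L dx)`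
the `δ`-difference of `∇g` is of second order by symmetry of the Hessian, so that replacing `J dx`
by `L dx` trades `∇_y g` for `-δ ∇_y f` via stationarity. -/
theorem abs_finiteDifference_sub_le {f g : Pt n m → ℝ} {X : Set (Vec n)}
    {Cf Lf Cg Sg μ δ j l a : ℝ} {x : Vec n} (hf : UpperLevelRegular f (cylinder m X) Cf Lf)
    (hg : LowerLevelRegular g X Cg Sg μ) (hX : IsOpen X) (hx : x ∈ X)
    (hCf : 0 ≤ Cf) (hCg : 0 ≤ Cg) (hSg : 0 ≤ Sg) (hδ : 0 < δ) (hδ1 : δ ≤ 1)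
    {ys y yδ : Vec m} {L J : Vec n →L[ℝ] Vec m} {Λ : Vec n →L[ℝ] (Fin p ⊕ {i // i ∈ I} → ℝ)}
    (hL : IsSensitivity M I (fderiv ℝ (gradient g) (pt x ys)) L Λ)
    (hJ : ∀ dx, Matrix.mulVec (M.stackB I) (J dx).ofLp = -Matrix.mulVec (M.stackA I) dx.ofLp)
    (hj : ‖J‖ ≤ j) (hl : ∀ dx, ‖L dx - J dx‖ ≤ l * ‖dx‖)
    (hst : ∀ v : Vec m, Matrix.mulVec (M.stackB I) v.ofLp = 0 →
      inner ℝ (gradient g (pt x ys)).snd v = 0)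
    (hy : ‖y - ys‖ ≤ δ ^ 2) (hker : Matrix.mulVec (M.stackB I) (yδ - ys).ofLp = 0)
    (hyδ : ‖yδ - ys‖ ≤ δ * a)
    (hres : ∀ v : Vec m, Matrix.mulVec (M.stackB I) v.ofLp = 0 →
      |inner ℝ ((gradient g (pt x yδ)).snd + δ • (gradient f (pt x yδ)).snd) v| ≤ δ ^ 2 * ‖v‖)
    (dx : Vec n) :
    |(1 / δ) * (inner ℝ (gradient g (pt x yδ) - gradient g (pt x y)) (pt dx (J dx))
        + δ * inner ℝ (gradient f (pt x yδ)).snd (J dx))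
      + inner ℝ (gradient f (pt x y)).fst dx - inner ℝ (gradient f (pt x ys)) (pt dx (L dx))|
      ≤ (Cf + Cg * (1 + j) + Sg * a ^ 2 * (1 + j + l) + l + Cf * a * (j + l)) * δ * ‖dx‖ := by
  set H := fderiv ℝ (gradient g) (pt x ys)
  have hJdx : ‖J dx‖ ≤ j * ‖dx‖ := J.le_of_opNorm_le hj dx
  have hLdx : ‖L dx‖ ≤ (j + l) * ‖dx‖ := by
    have h := norm_add_le (J dx) (L dx - J dx)
    rw [add_sub_cancel] at h
    linarith [hl dx]
  have hℓker : Matrix.mulVec (M.stackB I) (L dx - J dx).ofLp = 0 := by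
    rw [WithLp.ofLp_sub, Matrix.mulVec_sub, hL.tangent, hJ, sub_self]
  have hmem : ∀ y : Vec m, pt x y ∈ cylinder m X := fun _ => hx
  have hfy : ∀ y y' : Vec m,
      ‖gradient f (pt x y) - gradient f (pt x y')‖ ≤ Cf * ‖y - y'‖ := fun y y' => by
    simpa [pt_sub_pt, norm_pt_zero_left] using hf.smooth _ (hmem y) _ (hmem y')
  have hgy : ∀ y y' : Vec m,
      ‖gradient g (pt x y) - gradient g (pt x y')‖ ≤ Cg * ‖y - y'‖ := fun y y' => by
    simpa [pt_sub_pt, norm_pt_zero_left] using hg.smooth _ (hmem y) _ (hmem y')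
  have hδ2 : δ ^ 2 ≤ δ := by nlinarith
  have hd := norm_nonneg dx
  have hj0 : 0 ≤ j := (norm_nonneg _).trans hj
  -- the five contributions to the error
  have t1 : |inner ℝ (gradient f (pt x y) - gradient f (pt x ys)).fst dx| ≤ Cf * δ * ‖dx‖ := by
    refine (abs_real_inner_le_norm _ _).trans ?_
    gcongr
    exact (norm_fst_le_norm _).trans ((hfy _ _).trans (by gcongr; exact hy.trans hδ2))
  have t2 : |inner ℝ (gradient g (pt x ys) - gradient g (pt x y)) (pt dx (J dx))|
      ≤ δ * (Cg * (1 + j) * δ * ‖dx‖) := by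
    refine (abs_real_inner_le_norm _ _).trans ?_
    calc _ ≤ (Cg * δ ^ 2) * (‖dx‖ + j * ‖dx‖) := by
          gcongr
          · refine (hgy _ _).trans ?_
            rw [norm_sub_rev]
            gcongr
          · exact (norm_pt_le _ _).trans (by gcongr)
      _ = _ := by ring
  have hsymm : inner ℝ (H (pt 0 (yδ - ys))) (pt dx (L dx)) = 0 := by
    rw [hg.hessian_symm hX (hmem ys), real_inner_comm, inner_pt_right,
      eq_neg_of_add_eq_zero_left (hL.stationary dx), inner_neg_left,
      inner_toLp_transpose_mulVec, hker]
    simp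
  have t3 : |inner ℝ (gradient g (pt x yδ) - gradient g (pt x ys)) (pt dx (L dx))|
      ≤ δ * (Sg * a ^ 2 * (1 + j + l) * δ * ‖dx‖) := by
    have e : inner ℝ (gradient g (pt x yδ) - gradient g (pt x ys)) (pt dx (L dx))
        = inner ℝ (gradient g (pt x yδ) - gradient g (pt x ys) - H (pt 0 (yδ - ys)))
          (pt dx (L dx)) := by
      rw [inner_sub_left _ (H _), hsymm, sub_zero]
    rw [e]
    refine (abs_real_inner_le_norm _ _).trans ?_
    calc _ ≤ (Sg * (δ * a) ^ 2) * (‖dx‖ + (j + l) * ‖dx‖) := by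
          gcongr
          · exact (hg.norm_gradient_taylor_le hSg hx ys yδ).trans (by gcongr)
          · exact (norm_pt_le _ _).trans (by gcongr)
      _ = _ := by ring
  have t4 : |inner ℝ ((gradient g (pt x yδ)).snd + δ • (gradient f (pt x yδ)).snd) (L dx - J dx)|
      ≤ δ * (l * δ * ‖dx‖) := by
    refine (hres _ hℓker).trans ?_
    calc _ ≤ δ ^ 2 * (l * ‖dx‖) := by gcongr; exact hl dx
      _ = _ := by ring
  have t5 : |inner ℝ (gradient f (pt x yδ) - gradient f (pt x ys)).snd (L dx)|
      ≤ Cf * a * (j + l) * δ * ‖dx‖ := by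
    refine (abs_real_inner_le_norm _ _).trans ?_
    calc _ ≤ (Cf * (δ * a)) * ((j + l) * ‖dx‖) := by
          have h : ‖(gradient f (pt x yδ) - gradient f (pt x ys)).snd‖ ≤ Cf * (δ * a) :=
            (norm_snd_le_norm _).trans ((hfy _ _).trans (by gcongr))
          exact mul_le_mul h hLdx (norm_nonneg _) ((norm_nonneg _).trans h)
      _ = _ := by ring
  have hst' := hst _ hℓker
  have key : (1 / δ) * (inner ℝ (gradient g (pt x yδ) - gradient g (pt x y)) (pt dx (J dx))
        + δ * inner ℝ (gradient f (pt x yδ)).snd (J dx))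
      + inner ℝ (gradient f (pt x y)).fst dx - inner ℝ (gradient f (pt x ys)) (pt dx (L dx))
      = inner ℝ (gradient f (pt x y) - gradient f (pt x ys)).fst dx
        + (1 / δ) * inner ℝ (gradient g (pt x ys) - gradient g (pt x y)) (pt dx (J dx))
        + (1 / δ) * inner ℝ (gradient g (pt x yδ) - gradient g (pt x ys)) (pt dx (L dx))
        - (1 / δ) * inner ℝ ((gradient g (pt x yδ)).snd + δ • (gradient f (pt x yδ)).snd)
            (L dx - J dx)
        + inner ℝ (gradient f (pt x yδ) - gradient f (pt x ys)).snd (L dx) := by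
    simp only [inner_sub_right] at hst'
    simp only [inner_pt_right, WithLp.sub_fst, WithLp.sub_snd, inner_sub_left, inner_sub_right,
      inner_add_left, inner_smul_left, RCLike.conj_to_real]
    field_simp
    linear_combination hst'
  have hdiv : ∀ {b t : ℝ}, |b| ≤ δ * t → |(1 / δ) * b| ≤ t := fun {b t} h => by
    rw [abs_mul, abs_of_pos (by positivity : 0 < 1 / δ), one_div, inv_mul_le_iff₀ hδ]
    exact h
  rw [key]
  have a2 := abs_le.1 (hdiv t2)
  have a3 := abs_le.1 (hdiv t3)
  have a4 := abs_le.1 (hdiv t4)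
  have a1 := abs_le.1 t1
  have a5 := abs_le.1 t5
  rw [abs_le]
  constructor <;> linarith

end Error

/-! ### Convergence of the inner loops -/

section InnerLoops

variable {n m p q : ℕ} {M : ConstraintMatrices n m p q} {I : Finset (Fin q)}

theorem norm_projGradStep_sub_le {K : Set (Vec m)} (hne : K.Nonempty) (hcl : IsClosed K)
    (hconv : Convex ℝ K) {G : Vec m → Vec m} {L s ρ : ℝ} (hL : 0 < L)
    (hG : ∀ y y', ‖L • (y - y') - (G y - G y')‖ ≤ s * ‖y - y'‖) (hs : s ≤ ρ * L) (y y' : Vec m) :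
    ‖metricProj K (y - (1 / L) • G y) - metricProj K (y' - (1 / L) • G y')‖
      ≤ ρ * ‖y - y'‖ := by
  refine (norm_metricProj_sub_metricProj_le hne hcl hconv _ _).trans ?_
  have e : (y - (1 / L) • G y) - (y' - (1 / L) • G y')
      = (1 / L) • (L • (y - y') - (G y - G y')) := by
    rw [smul_sub, smul_smul, one_div_mul_cancel hL.ne', one_smul, smul_sub]
    abel
  rw [e, norm_smul, Real.norm_of_nonneg (by positivity), one_div, inv_mul_le_iff₀ hL]
  refine (hG y y').trans ?_
  calc s * ‖y - y'‖ ≤ ρ * L * ‖y - y'‖ := by gcongr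
    _ = _ := by ring

/-- Linear convergence of projected gradient descent to the lower-level solution. -/
theorem norm_lowerIterate_sub_le {ce : Fin p → ℝ} {ch : Fin q → ℝ} {g : Pt n m → ℝ}
    {X : Set (Vec n)} {C S μ ρ : ℝ} (hg : LowerLevelRegular g X C S μ) (hX : IsOpen X)
    (hC : 0 < C) {x : Vec n} (hx : x ∈ X) {ys : Vec m} (hsol : M.IsLowerSolution ce ch g x ys)
    (hρ : 0 ≤ ρ) (hρC : C - μ ≤ ρ * C) (y₀ : Vec m) (T : ℕ) :
    ‖(fun y => metricProj (M.feasible ce ch x)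
      (y - (1 / C) • (gradient g (pt x y)).snd))^[T] y₀ - ys‖ ≤ ρ ^ T * ‖y₀ - ys‖ := by
  have hne : (M.feasible ce ch x).Nonempty := ⟨ys, hsol.1⟩
  have hcl := M.isClosed_feasible ce ch x
  have hconv := M.convex_feasible ce ch x
  refine norm_iterate_sub_le_of_isFixedPt hρ (norm_projGradStep_sub_le hne hcl hconv hC
    (fun y y' => hg.norm_smul_sub_gradient_le hX hC.le hx y y') hρC) ?_ y₀ T
  have h := norm_metricProj_sub_le hne hcl hconv 
    (u := ys - (1 / C) • (gradient g (pt x ys)).snd)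
    (u' := ys - (1 / C) • (gradient g (pt x ys)).snd) hsol.1 (fun w hw => ?_)
  · rw [sub_self, norm_zero] at h
    exact sub_eq_zero.1 (norm_le_zero_iff.1 h)
  · have h := inner_gradient_nonneg_of_isMinOn hconv (hg.hasGradientAt hx ys) hsol.1 hsol.2 hw
    rw [sub_sub_cancel_left, inner_neg_left, inner_smul_left, RCLike.conj_to_real]
    exact neg_nonpos.2 (mul_nonneg (by positivity) h)

/-- Stationarity residual of projected gradient descent on the perturbed ghost problem: the
gradient along the ghost feasible set is proportional to the difference of successive iterates,
which decays geometrically. -/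
theorem ghostIterate_residual_le {ce : Fin p → ℝ} {ch : Fin q → ℝ} {f g : Pt n m → ℝ}
    {X : Set (Vec n)} {Cf Lf Cg Sg μ ρ δ : ℝ} {x : Vec n}
    (hf : UpperLevelRegular f (cylinder m X) Cf Lf) (hg : LowerLevelRegular g X Cg Sg μ)
    (hX : IsOpen X) (hCf : 0 ≤ Cf) (hLf : 0 ≤ Lf) (hCg : 0 < Cg) (hx : x ∈ X) (hδ : 0 ≤ δ)
    {ys : Vec m} (hys : ys ∈ M.ghostFeasible ce ch I x)
    (hst : ∀ v : Vec m, Matrix.mulVec (M.stackB I) v.ofLp = 0 →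
      inner ℝ (gradient g (pt x ys)).snd v = 0)
    (hρ : 0 ≤ ρ) (hρ1 : ρ ≤ 1) (hρC : Cg - μ + 2 * (δ * Cf) ≤ ρ * (Cg + δ * Cf))
    (η : Fin p ⊕ {i // i ∈ I} → ℝ) (y : Vec m) (T : ℕ) (hT : 1 ≤ T) {yδ : Vec m}
    (hyδ : yδ = (fun y => metricProj (M.ghostFeasible ce ch I x) (y - (1 / (Cg + δ * Cf)) •
        ((gradient g (pt x y)).snd + WithLp.toLp 2 (Matrix.mulVec (M.stackB I).transpose η)
          + δ • (gradient f (pt x y)).snd)))^[T] y) :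
    Matrix.mulVec (M.stackB I) (yδ - ys).ofLp = 0 ∧
    ∀ v : Vec m, Matrix.mulVec (M.stackB I) v.ofLp = 0 →
      |inner ℝ ((gradient g (pt x yδ)).snd + δ • (gradient f (pt x yδ)).snd) v|
        ≤ ρ ^ T * (2 * (Cg + δ * Cf) * ‖y - ys‖ + δ * Lf) * ‖v‖ := by
  set K := M.ghostFeasible ce ch I x
  have hne : K.Nonempty := ⟨ys, hys⟩
  have hcl : IsClosed K := M.isClosed_ghostFeasible I ce ch x
  have hconv : Convex ℝ K := M.convex_ghostFeasible I ce ch x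
  set L := Cg + δ * Cf with hL_def
  have hL : 0 < L := add_pos_of_pos_of_nonneg hCg (mul_nonneg hδ hCf)
  set b : Vec m := WithLp.toLp 2 (Matrix.mulVec (M.stackB I).transpose η)
  have hb : ∀ v : Vec m, Matrix.mulVec (M.stackB I) v.ofLp = 0 → inner ℝ b v = 0 := by
    intro v hv
    rw [inner_toLp_transpose_mulVec, hv, dotProduct_zero]
  set G : Vec m → Vec m := fun y => (gradient g (pt x y)).snd + b + δ • (gradient f (pt x y)).snd
    with hG
  set Ψ : Vec m → Vec m := fun y => metricProj K (y - (1 / L) • G y) with hΨ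
  have hmem : ∀ u, Ψ u ∈ K := fun u => (metricProj_mem_and_inner_le hne hcl hconv _).1
  have hfy : ∀ y y' : Vec m,
      ‖(gradient f (pt x y)).snd - (gradient f (pt x y')).snd‖ ≤ Cf * ‖y - y'‖ := fun y y' => by
    refine (norm_snd_le_norm (gradient f (pt x y) - gradient f (pt x y'))).trans ?_
    simpa [pt_sub_pt, norm_pt_zero_left] using hf.smooth (pt x y) hx (pt x y') hx
  -- the upper-level objective is not convex: its smoothness costs `2 δ Cf` in the contraction
  have hcontr : ∀ y y', ‖Ψ y - Ψ y'‖ ≤ ρ * ‖y - y'‖ := by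
    refine norm_projGradStep_sub_le hne hcl hconv hL (fun y y' => ?_) hρC
    have e : L • (y - y') - (G y - G y')
        = (Cg • (y - y') - ((gradient g (pt x y)).snd - (gradient g (pt x y')).snd))
          + δ • (Cf • (y - y') - ((gradient f (pt x y)).snd - (gradient f (pt x y')).snd)) := by
      rw [hG, hL_def]
      module
    rw [e]
    have h1 := hg.norm_smul_sub_gradient_le hX hCg.le hx y y'
    have h2 : ‖δ • (Cf • (y - y') - ((gradient f (pt x y)).snd - (gradient f (pt x y')).snd))‖
        ≤ δ * (Cf * ‖y - y'‖ + Cf * ‖y - y'‖) := by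
      rw [norm_smul, Real.norm_of_nonneg hδ]
      gcongr
      refine (norm_sub_le _ _).trans (add_le_add (le_of_eq ?_) (hfy y y'))
      rw [norm_smul, Real.norm_of_nonneg hCf]
    refine (norm_add_le _ _).trans ((add_le_add h1 h2).trans (le_of_eq (by ring)))
  have hys_step : ‖Ψ ys - ys‖ ≤ δ * Lf / L := by
    refine (norm_metricProj_sub_le hne hcl hconv
      (u' := ys - (1 / L) • ((gradient g (pt x ys)).snd + b)) hys (fun w hw => ?_)).trans ?_
    · have hw' := M.stackB_sub_eq_zero hw hys
      rw [sub_sub_cancel_left, inner_neg_left, inner_smul_left, inner_add_left, hst _ hw',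
        hb _ hw']
      simp
    · have e : (ys - (1 / L) • G ys) - (ys - (1 / L) • ((gradient g (pt x ys)).snd + b))
          = -((1 / L) • (δ • (gradient f (pt x ys)).snd)) := by
        rw [hG]
        module
      rw [e, norm_neg, norm_smul, norm_smul, Real.norm_of_nonneg hδ,
        Real.norm_of_nonneg (by positivity), one_div, inv_mul_eq_div]
      gcongr
      exact (norm_snd_le_norm _).trans (hf.norm_gradient_le (isOpen_cylinder hX) hLf hx)
  have hfirst : ‖Ψ y - y‖ ≤ 2 * ‖y - ys‖ + δ * Lf / L := by
    have h1 : Ψ y - y = (Ψ y - Ψ ys) + (Ψ ys - ys) + (ys - y) := by abel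
    have h2 : ‖Ψ y - Ψ ys‖ ≤ ‖y - ys‖ :=
      (hcontr y ys).trans (mul_le_of_le_one_left (norm_nonneg _) hρ1)
    rw [h1]
    refine norm_add₃_le.trans ?_
    rw [norm_sub_rev ys y]
    linarith
  have hyδ' : yδ = Ψ^[T] y := hyδ
  have hdiff : ‖Ψ yδ - yδ‖ ≤ ρ ^ T * (2 * ‖y - ys‖ + δ * Lf / L) := by
    rw [hyδ']
    refine (norm_iterate_succ_sub_le hρ hcontr y T).trans ?_
    gcongr
  have hyδK : yδ ∈ K := by
    obtain ⟨T, rfl⟩ : ∃ T', T = T' + 1 := ⟨T - 1, by omega⟩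
    rw [hyδ', Function.iterate_succ_apply']
    exact hmem _
  refine ⟨M.stackB_sub_eq_zero hyδK hys, fun v hv => ?_⟩
  have hvi := (metricProj_mem_and_inner_le hne hcl hconv (yδ - (1 / L) • G yδ)).2
  have hP := hmem yδ
  -- both `Ψ yδ + v` and `Ψ yδ - v` are feasible, so the variational inequality is an equality
  have h1 := hvi _ (M.add_mem_ghostFeasible hP hv)
  have h2 := hvi _ (M.add_mem_ghostFeasible hP (v := -v) (by simp [Matrix.mulVec_neg, hv]))
  change inner ℝ (yδ - (1 / L) • G yδ - Ψ yδ) (Ψ yδ + v - Ψ yδ) ≤ 0 at h1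
  change inner ℝ (yδ - (1 / L) • G yδ - Ψ yδ) (Ψ yδ + -v - Ψ yδ) ≤ 0 at h2
  rw [add_sub_cancel_left] at h1 h2
  rw [inner_neg_right] at h2
  have h3 : inner ℝ (yδ - (1 / L) • G yδ - Ψ yδ) v = 0 := by linarith
  have e : yδ - (1 / L) • G yδ - Ψ yδ = -(Ψ yδ - yδ) - (1 / L) • G yδ := by abel
  rw [e, inner_sub_left, inner_neg_left, inner_smul_left, RCLike.conj_to_real] at h3
  have h4 : inner ℝ (G yδ) v
      = inner ℝ ((gradient g (pt x yδ)).snd + δ • (gradient f (pt x yδ)).snd) v := by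
    simp only [hG, inner_add_left, hb v hv, add_zero]
  rw [← h4]
  have h5 : inner ℝ (G yδ) v = -(L * inner ℝ (Ψ yδ - yδ) v) := by
    field_simp at h3
    linarith
  rw [h5, abs_neg, abs_mul, abs_of_pos hL]
  calc L * |inner ℝ (Ψ yδ - yδ) v| ≤ L * (ρ ^ T * (2 * ‖y - ys‖ + δ * Lf / L) * ‖v‖) := by
        gcongr
        exact (abs_real_inner_le_norm _ _).trans (by gcongr)
    _ = _ := by field_simp

/-- Both inner loops reach accuracy `δ²`. In the zero space (where `Cg` may vanish) there is nothing
to show; otherwise `μ ≤ Cg`. -/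
theorem innerLoops_accuracy {ce : Fin p → ℝ} {ch : Fin q → ℝ} {f g : Pt n m → ℝ}
    {X : Set (Vec n)} {Cf Lf Cg Sg μ ρ δ D : ℝ} {x : Vec n}
    (hf : UpperLevelRegular f (cylinder m X) Cf Lf) (hg : LowerLevelRegular g X Cg Sg μ)
    (hX : IsOpen X) (hCf : 0 ≤ Cf) (hLf : 0 ≤ Lf) (hCg : 0 ≤ Cg) (hμ : 0 < μ) (hx : x ∈ X)
    (hδ : 0 ≤ δ) (hδ1 : δ ≤ 1) {ys : Vec m} (hsol : M.IsLowerSolution ce ch g x ys)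
    (hys : ys ∈ M.ghostFeasible ce ch I x)
    (hst : ∀ v : Vec m, Matrix.mulVec (M.stackB I) v.ofLp = 0 →
      inner ℝ (gradient g (pt x ys)).snd v = 0)
    (hρ : 0 ≤ ρ) (hρ1 : ρ ≤ 1) (hρg : Cg - μ ≤ ρ * Cg)
    (hρC : Cg - μ + 2 * (δ * Cf) ≤ ρ * (Cg + δ * Cf)) {y₀ : Vec m} (hy₀ : ‖y₀ - ys‖ ≤ D)
    (η : Fin p ⊕ {i // i ∈ I} → ℝ) {T : ℕ} (hT1 : 1 ≤ T)
    (hT : ρ ^ T * ((2 * (Cg + Cf) + Lf + 1) * (1 + D)) ≤ δ ^ 2) {y yδ : Vec m}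
    (hy : y = (fun y => metricProj (M.feasible ce ch x)
      (y - (1 / Cg) • (gradient g (pt x y)).snd))^[T] y₀)
    (hyδ : yδ = (fun y => metricProj (M.ghostFeasible ce ch I x) (y - (1 / (Cg + δ * Cf)) •
        ((gradient g (pt x y)).snd + WithLp.toLp 2 (Matrix.mulVec (M.stackB I).transpose η)
          + δ • (gradient f (pt x y)).snd)))^[T] y) :
    ‖y - ys‖ ≤ δ ^ 2 ∧ Matrix.mulVec (M.stackB I) (yδ - ys).ofLp = 0 ∧
      ∀ v : Vec m, Matrix.mulVec (M.stackB I) v.ofLp = 0 →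
        |inner ℝ ((gradient g (pt x yδ)).snd + δ • (gradient f (pt x yδ)).snd) v|
          ≤ δ ^ 2 * ‖v‖ := by
  rcases subsingleton_or_nontrivial (Vec m) with hm | hm
  · refine ⟨?_, ?_, fun v hv => ?_⟩
    · rw [Subsingleton.elim y ys, sub_self, norm_zero]
      positivity
    · rw [Subsingleton.elim (yδ - ys) 0]
      simp
    · rw [Subsingleton.elim v 0]
      simp
  have hCg' : 0 < Cg := by
    obtain ⟨v, hv⟩ := exists_ne (0 : Vec m)
    have h := (norm_nonneg _).trans (hg.norm_smul_sub_gradient_le hX hCg hx v 0)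
    rw [sub_zero] at h
    have := nonneg_of_mul_nonneg_left h (norm_pos_iff.2 hv)
    linarith
  have hD : 0 ≤ D := (norm_nonneg _).trans hy₀
  have hyρ : ‖y - ys‖ ≤ ρ ^ T * D := by
    rw [hy]
    refine (norm_lowerIterate_sub_le hg hX hCg' hx hsol hρ hρg y₀ T).trans ?_
    gcongr
  have hyD : ‖y - ys‖ ≤ D := hyρ.trans (mul_le_of_le_one_left hD (pow_le_one₀ hρ hρ1))
  obtain ⟨hker, hres⟩ := ghostIterate_residual_le hf hg hX hCf hLf hCg' hx hδ hys hst hρ hρ1 hρC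
    η y T hT1 hyδ
  have hexp : (2 * (Cg + Cf) + Lf + 1) * (1 + D)
      = 2 * (Cg + Cf) * D + Lf + D + (2 * (Cg + Cf) + Lf * D + 1) := by ring
  have hpos : 0 ≤ 2 * (Cg + Cf) + Lf * D + 1 := by positivity
  refine ⟨hyρ.trans (le_trans ?_ hT), hker, fun v hv => (hres v hv).trans ?_⟩
  · gcongr
    have h1 : 0 ≤ 2 * (Cg + Cf) * D := by positivity
    linarith
  · gcongr
    refine le_trans ?_ hT
    gcongr
    have h1 : δ * Cf ≤ Cf := mul_le_of_le_one_left hCf hδ1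
    have h2 : δ * Lf ≤ Lf := mul_le_of_le_one_left hLf hδ1
    have h3 : 2 * (Cg + δ * Cf) * ‖y - ys‖ ≤ 2 * (Cg + Cf) * D := by gcongr
    linarith

end InnerLoops

/-! ### Accuracy and oracle complexity -/

/-- Logarithmically many steps of a `ρ`-contraction reach the accuracy `δ²` with
`δ = c min {ε, 1}`. -/
theorem exists_stepCount {ρ A c : ℝ} (hρ : 0 < ρ) (hρ1 : ρ < 1) (hA : 1 ≤ A) (hc : 0 < c)
    (hc1 : c ≤ 1) : ∃ K : ℝ, 0 < K ∧ ∀ ε D : ℝ, 0 < ε → 0 ≤ D → ∃ T : ℕ, 1 ≤ T ∧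
      ρ ^ T * (A * (1 + D)) ≤ (c * min ε 1) ^ 2 ∧
      ((3 * T + 4 : ℕ) : ℝ) ≤ K * Real.log (2 + D + 1 / ε) := by
  have hlogρ : 0 < -Real.log ρ := neg_pos.2 (Real.log_neg hρ hρ1)
  have hlog2 : 0 < Real.log 2 := Real.log_pos one_lt_two
  have hAc : 1 ≤ A / c ^ 2 := by
    rw [le_div_iff₀ (by positivity), one_mul]
    exact (pow_le_one₀ hc.le hc1).trans hA
  -- `β log s` absorbs `log (A / c²)` since `log 2 ≤ log s`, and `3 log s` the factor `s³` that
  -- comes from `1 + D ≤ s` and `1 / s ≤ min ε 1`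
  set β := Real.log (A / c ^ 2) / Real.log 2
  have hβ : 0 ≤ β := div_nonneg (Real.log_nonneg hAc) hlog2.le
  set κ := (β + 3) / (-Real.log ρ)
  have hκ : 0 < κ := div_pos (by linarith) hlogρ
  refine ⟨3 * κ + 7 / Real.log 2, by positivity, fun ε D hε hD => ?_⟩
  set s := 2 + D + 1 / ε
  have hε' : 0 < 1 / ε := by positivity
  have hs2 : 2 ≤ s := by simp only [s]; linarith
  have hs0 : 0 < s := by linarith
  have hlogs : Real.log 2 ≤ Real.log s := Real.log_le_log two_pos hs2
  have hlogs0 : 0 < Real.log s := hlog2.trans_le hlogs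
  refine ⟨⌈κ * Real.log s⌉₊, Nat.one_le_ceil_iff.2 (by positivity), ?_, ?_⟩
  · have h1 : (β + 3) * Real.log s ≤ ⌈κ * Real.log s⌉₊ * (-Real.log ρ) := by
      have := mul_le_mul_of_nonneg_right (Nat.le_ceil (κ * Real.log s)) hlogρ.le
      have e : κ * Real.log s * (-Real.log ρ) = (β + 3) * Real.log s := by
        simp only [κ]
        rw [mul_right_comm, div_mul_cancel₀ _ hlogρ.ne']
      linarith
    have h2 : Real.log (A / c ^ 2) ≤ β * Real.log s := by
      have e : Real.log (A / c ^ 2) = β * Real.log 2 := by simp only [β]; field_simp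
      rw [e]
      gcongr
    have h3 : ρ ^ ⌈κ * Real.log s⌉₊ * ((A / c ^ 2) * s ^ 3) ≤ 1 := by
      rw [← Real.log_nonpos_iff (by positivity), Real.log_mul (by positivity) (by positivity),
        Real.log_mul (by positivity) (by positivity), Real.log_pow, Real.log_pow]
      push_cast
      linarith
    have hmin : 1 / s ≤ min ε 1 := by
      refine le_min ?_ ?_
      · rw [one_div_le hs0 hε]
        simp only [s]; linarith
      · rw [div_le_one hs0]; linarith
    have hDs : 1 + D ≤ s := by simp only [s]; linarith
    calc _ ≤ ρ ^ ⌈κ * Real.log s⌉₊ * (A * s) := by gcongr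
      _ = (ρ ^ ⌈κ * Real.log s⌉₊ * ((A / c ^ 2) * s ^ 3)) * (c * (1 / s)) ^ 2 := by field_simp
      _ ≤ 1 * (c * min ε 1) ^ 2 := by gcongr
      _ = _ := one_mul _
  · have h1 := (Nat.ceil_lt_add_one (by positivity : 0 ≤ κ * Real.log s)).le
    have h2 : 7 ≤ 7 / Real.log 2 * Real.log s := by
      rw [div_mul_eq_mul_div, le_div_iff₀ hlog2]
      gcongr
    push_cast
    linarith

theorem mainTheorem1 {n m p q : ℕ} (M : ConstraintMatrices n m p q)
    (Cf Lf Cg Sg μg : ℝ) (hCf : 0 ≤ Cf) (hLf : 0 ≤ Lf) (hCg : 0 ≤ Cg) (hSg : 0 ≤ Sg)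
    (hμg : 0 < μg) :
    ∃ c K : ℝ, 0 < c ∧ 0 < K ∧ ∀ ε D : ℝ, 0 < ε → 0 ≤ D → ∃ T : ℕ,
      ∀ (ce : Fin p → ℝ) (ch : Fin q → ℝ) (X : Set (Vec n)) (f g : Pt n m → ℝ)
        (ystar : Vec n → Vec m) (x : Vec n) (y₀ : Vec m) (I : Finset (Fin q)),
        IsOpen X → x ∈ X →
        UpperLevelRegular f (cylinder m X) Cf Lf →
        LowerLevelRegular g X Cg Sg μg →
        (∀ x' ∈ X, M.IsLowerSolution ce ch g x' (ystar x')) →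
        (∀ i, i ∈ I ↔ M.ineqCon ch x (ystar x) i = 0) →
        M.LICQ I →
        M.StrictComplementarity ce ch g I x (ystar x) →
        ‖y₀ - ystar x‖ ≤ D →
        DifferentiableAt ℝ (fun x' => f (pt x' (ystar x'))) x ∧
        ‖(hypergradientOracle M ce ch Cf Cg I (c * min ε 1) T x y₀).output
              (gradient f) (gradient g)
            - gradient (fun x' => f (pt x' (ystar x'))) x‖ ≤ ε ∧
        ((hypergradientOracle M ce ch Cf Cg I (c * min ε 1) T x y₀).queries
            (gradient f) (gradient g) : ℝ) ≤ K * Real.log (2 + D + 1 / ε) := by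
  -- `j` bounds the compensating displacements for all active sets at once
  set j : ℝ := ∑ I, ‖M.compensation I‖
  have hj0 : 0 ≤ j := Finset.sum_nonneg fun _ _ => norm_nonneg _
  set l : ℝ := Cg * (1 + j) / μg
  have hl0 : 0 ≤ l := by positivity
  set a : ℝ := (Lf + 1) / μg
  have ha0 : 0 ≤ a := by positivity
  set Γ : ℝ := Cf + Cg * (1 + j) + Sg * a ^ 2 * (1 + j + l) + l + Cf * a * (j + l)
  have hΓ : 0 ≤ Γ := by positivity
  -- `c` makes `δ Cf` small against `μg`, so that the perturbed ghost steps still contract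
  set c : ℝ := min 1 (min (μg / (4 * (Cf + 1))) (1 / (Γ + 1)))
  have hc : 0 < c := by positivity
  have hc1 : c ≤ 1 := min_le_left _ _
  have hcf : c * Cf ≤ μg / 4 := by
    have h : c ≤ μg / (4 * (Cf + 1)) := (min_le_right _ _).trans (min_le_left _ _)
    rw [le_div_iff₀ (by positivity)] at h
    nlinarith
  have hcΓ : Γ * c ≤ 1 := by
    have h : c ≤ 1 / (Γ + 1) := (min_le_right _ _).trans (min_le_right _ _)
    rw [le_div_iff₀ (by positivity)] at h
    nlinarith
  -- a contraction factor for both inner loops, positive even if `Cg = 0`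
  set ρ : ℝ := (2 * Cg + μg) / (2 * Cg + 2 * μg) with hρ_def
  have hρ0 : 0 < ρ := by positivity
  have hρ1 : ρ < 1 := by rw [hρ_def, div_lt_one (by positivity)]; linarith
  have hρC : (1 - ρ) * Cg ≤ μg / 2 := by
    have e : 1 - ρ = μg / (2 * Cg + 2 * μg) := by rw [hρ_def]; field_simp; ring
    rw [e, div_mul_eq_mul_div, div_le_div_iff₀ (by positivity) two_pos]
    nlinarith [sq_nonneg μg]
  set A : ℝ := 2 * (Cg + Cf) + Lf + 1
  have hA : 1 ≤ A := by simp only [A]; linarith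
  obtain ⟨K, hK, hsteps⟩ := exists_stepCount hρ0 hρ1 hA hc hc1
  refine ⟨c, K, hc, hK, fun ε D hε hD => ?_⟩
  obtain ⟨T, hT1, hT, hTK⟩ := hsteps ε D hε hD
  refine ⟨T, fun ce ch X f g ystar x y₀ I hX hx hf hg hsol hI hLICQ hSC hy₀ => ?_⟩
  set δ : ℝ := c * min ε 1
  have hmin : 0 < min ε 1 := lt_min hε one_pos
  have hδ : 0 < δ := mul_pos hc hmin
  have hδc : δ ≤ c := mul_le_of_le_one_right hc.le (min_le_right _ _)
  have hδ1 : δ ≤ 1 := hδc.trans hc1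
  have hδf : δ * Cf ≤ μg / 4 := (mul_le_mul_of_nonneg_right hδc hCf).trans hcf
  have hz : pt x (ystar x) ∈ cylinder m X := hx
  obtain ⟨η, hη, hst⟩ := hSC.exists_multiplier hI
  obtain ⟨L, Λ, hL⟩ := hLICQ.exists_isSensitivity hμg _ (hg.hessian_coercive hx (ystar x))
  have hyd := hasFDerivAt_lowerSolution hg hX hμg hx hsol hI hη hst hL
  have hF : HasFDerivAt (fun x' => f (pt x' (ystar x')))
      ((fderiv ℝ f (pt x (ystar x))).comp (ptL (ContinuousLinearMap.id ℝ (Vec n)) L)) x :=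
    (hf.differentiable _ hz).hasFDerivAt.comp x (hasFDerivAt_pt (hasFDerivAt_id x) hyd)
  have hgradF : ∀ dx, inner ℝ (gradient (fun x' => f (pt x' (ystar x'))) x) dx
      = inner ℝ (gradient f (pt x (ystar x))) (pt dx (L dx)) := by
    intro dx
    rw [gradient, gradient, InnerProductSpace.toDual_symm_apply,
      InnerProductSpace.toDual_symm_apply, hF.fderiv]
    rfl
  refine ⟨hF.differentiableAt, ?_, by rwa [queries_hypergradientOracle]⟩
  obtain ⟨η', y, yδ, hy, hyδ, hout⟩ := exists_inner_output_hypergradientOracle M ce ch Cf Cg I δ T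
    x y₀ hLICQ (gradient f) (gradient g)
  have hst' : ∀ v : Vec m, Matrix.mulVec (M.stackB I) v.ofLp = 0 →
      inner ℝ (gradient g (pt x (ystar x))).snd v = 0 := by
    intro v hv
    rw [eq_neg_of_add_eq_zero_left hst, inner_neg_left, inner_toLp_transpose_mulVec, hv,
      dotProduct_zero, neg_zero]
  have hys : ystar x ∈ M.ghostFeasible ce ch I x :=
    ⟨(hsol x hx).1.2, fun i hi => (hI i).1 hi⟩
  obtain ⟨hyδ2, hker, hres⟩ := innerLoops_accuracy hf hg hX hCf hLf hCg hμg hx hδ.le hδ1 (hsol x hx)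
    hys hst' hρ0.le hρ1.le (by linarith) (by nlinarith) hy₀ η' hT1 hT hy hyδ
  have hdist : ‖yδ - ystar x‖ ≤ δ * a := by
    refine (hg.norm_sub_le_of_residual hμg hx hδ.le (sq_nonneg δ)
      (hf.norm_gradient_le (isOpen_cylinder hX) hLf hx) (hst' _ hker) (hres _ hker)).trans ?_
    rw [← mul_div_assoc]
    gcongr
    nlinarith
  have hj : ‖M.compensation I‖ ≤ j :=
    Finset.single_le_sum (f := fun I => ‖M.compensation I‖) (fun _ _ => norm_nonneg _)
      (Finset.mem_univ I)
  have herr := abs_finiteDifference_sub_le hf hg hX hx hCf hCg hSg hδ hδ1 hL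
    hLICQ.stackB_compensation hj (fun dx => hL.norm_sub_le hμg (hg.norm_hessian_le hX hCg hz)
      (hg.hessian_coercive hx (ystar x)) hLICQ.stackB_compensation hj dx)
    hst' hyδ2 hker hdist hres
  set w := (hypergradientOracle M ce ch Cf Cg I δ T x y₀).output (gradient f) (gradient g)
    - gradient (fun x' => f (pt x' (ystar x'))) x with hw
  have hww : ‖w‖ * ‖w‖ ≤ Γ * δ * ‖w‖ := by
    rw [← real_inner_self_eq_norm_mul_norm]
    nth_rewrite 1 [hw]
    rw [inner_sub_left, hout, hgradF]
    exact (le_abs_self _).trans (herr w)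
  have hwΓ : ‖w‖ ≤ Γ * δ := by
    rcases (norm_nonneg w).eq_or_lt with h0 | h0
    · rw [← h0]; positivity
    · exact le_of_mul_le_mul_right hww h0
  calc ‖w‖ ≤ Γ * c * min ε 1 := by rw [mul_assoc]; exact hwΓ
    _ ≤ 1 * ε := by gcongr; exact min_le_left _ _
    _ = ε := one_mul ε
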